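/- Conventions. Manifolds are smooth ($C^\infty$), finite dimensional, Hausdorff, second countable and without boundary. Let $G$ be a Lie group with Lie algebra $\mathfrak g$, acting smoothly, freely and properly from the right on manifolds $Q$ and $P$; write $\Psi^M_g(m)=mg$ for the action on $M\in\{Q,P\}$ and $\xi_M(m)=\frac{d}{dt}\big|_{0}\, m\exp(t\xi)$ for $\xi\in\mathfrak g$. For $g\in G$ and $\nu\in\mathfrak g^*$ put $\langle \mathrm{Ad}^*_g\nu,\xi\rangle=\langle\nu,\mathrm{Ad}_g\xi\rangle$. Orbit spaces such as $Q/G$ carry their quotient manifold structure, i.e. the unique smooth structure for which the projection is a submersion; $\pi^Q:Q\to Q/G$ is the projection. Let $P$ be connected, let $\epsilon:P\to Q$ be a smooth fibre bundle with $\epsilon(pg)=\epsilon(p)g$, and let $$T_PQ=TQ\times_Q P=\{(v_q,p): v_q\in T_qQ,\ \epsilon(p)=q\},$$ with the lifted action $(v_q,p)\mapsto (T\Psi^Q_g(v_q),pg)$. Let $L:T_PQ\to\mathbb R$ be a smooth $G$-invariant function and $\mathcal B$ a smooth closed $G$-invariant $2$-form on $P$, so that $(\epsilon,L,\mathcal B)$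 is a $G$-invariant magnetic Lagrangian system. Let $\delta:P\to\mathfrak g^*$ be a smooth $\mathcal B\mathfrak g$-potential: $i_{\xi_P}\mathcal B=d\langle\delta,\xi\rangle$ for all $\xi\in\mathfrak g$. Define $J_{L,\delta}:T_PQ\to\mathfrak g^*$ by $$\langle J_{L,\delta}(v_q,p),\xi\rangle=\frac{d}{du}\Big|_{u=0}L(v_q+u\,\xi_Q(q),p)-\langle\delta(p),\xi\rangle .$$ Let $\sigma_\delta(g)=\delta(pg^{-1})-\mathrm{Ad}^*_{g^{-1}}\delta(p)$, which does not depend on $p\in P$. For $\mu\in\mathfrak g^*$ let $G_\mu=\{g\in G:\ \mu=\mathrm{Ad}^*_g\mu-\sigma_\delta(g^{-1})\}$, let $\tilde\epsilon:P/G_\mu\to Q/G$, $[p]_{G_\mu}\mapsto[\epsilon(p)]_G$, and let $T_{P/G_\mu}(Q/G)=T(Q/G)\times_{Q/G}P/G_\mu$. Proposition. Suppose that $L$ is $G$-regular, i.e. for every $(v_q,p)\in T_PQ$ the map $\mathfrak g\to\mathfrak g^*$, $\xi\mapsto J_{L,\delta}(v_q+\xi_Q(q),p)$, is a diffeomorphism.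 Let $\mu\in\mathfrak g^*$. Then $J_{L,\delta}^{-1}(\mu)$ is an embedded submanifold of $T_PQ$, its quotient $J_{L,\delta}^{-1}(\mu)/G_\mu$ is a quotient manifold, and the map $$\Pi_\mu:\ J_{L,\delta}^{-1}(\mu)/G_\mu\longrightarrow T_{P/G_\mu}(Q/G),\qquad [(v_q,p)]_{G_\mu}\longmapsto\big(T\pi^Q(v_q),[p]_{G_\mu}\big),$$ is well defined and a diffeomorphism. Its inverse is as follows: for every $(v_q,p)\in T_PQ$ there is a unique $\xi\in\mathfrak g$ with $J_{L,\delta}(v_q+\xi_Q(q),p)=\mu$, and $\Pi_\mu^{-1}\big(T\pi^Q(v_q),[p]_{G_\mu}\big)=[(v_q+\xi_Q(q),p)]_{G_\mu}$. -/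

import Mathlib

open scoped Manifold ContDiff
open Bundle MulOpposite

/-!
Conventions. Every manifold is a smooth (`C^∞`), finite dimensional manifold without boundary,
modelled on a finite dimensional normed space. A right action of `G` on `M` is an action of the
opposite group: `m g` is written `op g • m`. The Lie algebra `𝔤` of `G` is the tangent space
of `G` at `1`, which in Mathlib has the model space `EG` of `G` as its underlying vector space;
its dual `𝔤*` is `EG →L[ℝ] ℝ`.
-/

namespace MagneticRouth

noncomputable section

section Generalities

variable {EG : Type*} [NormedAddCommGroup EG] [NormedSpace ℝ EG]
  {G : Type*} [TopologicalSpace G] [ChartedSpace EG G] [Group G]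
  {EM : Type*} [NormedAddCommGroup EM] [NormedSpace ℝ EM]
  {M : Type*} [TopologicalSpace M] [ChartedSpace EM M]
  {EN : Type*} [NormedAddCommGroup EN] [NormedSpace ℝ EN]
  {N : Type*} [TopologicalSpace N] [ChartedSpace EN N]

variable (EG G EM M) in
/-- The right action of the Lie group `G` on the manifold `M` is smooth, free and proper. -/
structure IsSmoothFreeProper [MulAction Gᵐᵒᵖ M] : Prop where
  smooth : ContMDiff (𝓘(ℝ, EM).prod 𝓘(ℝ, EG)) 𝓘(ℝ, EM) ∞ (fun x : M × G => op x.2 • x.1)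
  free : ∀ (m : M) (g : G), op g • m = m → g = 1
  proper : ProperSMul Gᵐᵒᵖ M

variable (EG EM) in
/-- The infinitesimal action `ψ_m : 𝔤 → T_m M`, the tangent map at `1` of the orbit map
`g ↦ m g`. Thus `infAction EG EM G m ξ` is the value `ξ_M(m)` of the fundamental vector field. -/
def infAction (G : Type*) [TopologicalSpace G] [ChartedSpace EG G] [Group G]
    [MulAction Gᵐᵒᵖ M] (m : M) : EG →L[ℝ] TangentSpace 𝓘(ℝ, EM) m :=
  (mfderiv 𝓘(ℝ, EG) 𝓘(ℝ, EM) (fun g : G => op g • m) 1 : EG →L[ℝ] EM)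

variable (EG) in
/-- The adjoint action `Ad_g : 𝔤 → 𝔤`, the tangent map at `1` of `h ↦ g h g⁻¹`. -/
def Ad (g : G) : EG →L[ℝ] EG :=
  (mfderiv 𝓘(ℝ, EG) 𝓘(ℝ, EG) (fun h : G => g * h * g⁻¹) 1 : EG →L[ℝ] EG)

/-- The coadjoint (right) action `⟨Ad*_g μ, ξ⟩ = ⟨μ, Ad_g ξ⟩` of `G` on `𝔤*`. -/
def coAd (g : G) (μ : EG →L[ℝ] ℝ) : EG →L[ℝ] ℝ := μ.comp (Ad EG g)

variable (EM M) in
/-- Differential `2`-forms on `M`, without a smoothness condition. -/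
abbrev TwoForm : Type _ := ∀ m : M, (TangentSpace 𝓘(ℝ, EM) m) [⋀^Fin 2]→L[ℝ] ℝ

/-- The expression of a `2`-form in the preferred chart at `m₀`. -/
def TwoForm.inChart (B : TwoForm EM M) (m₀ : M) (x : EM) : EM [⋀^Fin 2]→L[ℝ] ℝ :=
  (B ((extChartAt 𝓘(ℝ, EM) m₀).symm x)).compContinuousLinearMap
    (mfderiv 𝓘(ℝ, EM) 𝓘(ℝ, EM) (extChartAt 𝓘(ℝ, EM) m₀).symm x)

/-- `B` is a smooth `2`-form with `dB = 0`. -/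
structure TwoForm.IsSmoothClosed (B : TwoForm EM M) : Prop where
  smooth : ∀ m₀, ContDiffOn ℝ ∞ (B.inChart m₀) (extChartAt 𝓘(ℝ, EM) m₀).target
  closed : ∀ m₀, ∀ x ∈ (extChartAt 𝓘(ℝ, EM) m₀).target, extDeriv (B.inChart m₀) x = 0

/-- `B` is invariant under the right action of `G`. -/
def TwoForm.IsInvariant (B : TwoForm EM M) (G : Type*) [Group G] [MulAction Gᵐᵒᵖ M] : Prop :=
  ∀ (g : G) (m : M), (B (op g • m)).compContinuousLinearMap
    (mfderiv 𝓘(ℝ, EM) 𝓘(ℝ, EM) (fun m' : M => op g • m') m) = B m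

variable (EM EN) in
/-- `f : M → N` is a smooth fibre bundle with typical fibre the manifold `F`. -/
structure IsSmoothFiberBundle (EF F : Type*) [NormedAddCommGroup EF] [NormedSpace ℝ EF]
    [TopologicalSpace F] [ChartedSpace EF F] (f : M → N) : Prop where
  locally_trivial : ∀ n : N, ∃ e : Trivialization F f, n ∈ e.baseSet ∧
    ContMDiffOn 𝓘(ℝ, EM) (𝓘(ℝ, EN).prod 𝓘(ℝ, EF)) ∞ e e.source ∧
    ContMDiffOn (𝓘(ℝ, EN).prod 𝓘(ℝ, EF)) 𝓘(ℝ, EM) ∞ e.toOpenPartialHomeomorph.symm e.target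

variable (EM EN) in
/-- The given charts on the quotient space `M / s` make it the quotient manifold of `M`: it is a
smooth manifold and the projection `M → M / s` is a submersion. There is at most one such smooth
structure. -/
structure IsQuotientManifold (s : Setoid M) [ChartedSpace EN (Quotient s)] : Prop where
  isManifold : IsManifold 𝓘(ℝ, EN) ∞ (Quotient s)
  isSubmersion : Manifold.IsSubmersion 𝓘(ℝ, EM) 𝓘(ℝ, EN) ∞ (Quotient.mk s)

/-- The given charts on the subset `S` of the manifold `M` (with the subspace topology) make it an
embedded submanifold. There is at most one such smooth structure. -/
structure IsEmbeddedSubmanifold {EM : Type*} [NormedAddCommGroup EM] [NormedSpace ℝ EM]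
    {H : Type*} [TopologicalSpace H] (I : ModelWithCorners ℝ EM H) {M : Type*}
    [TopologicalSpace M] [ChartedSpace H M] (EN : Type*) [NormedAddCommGroup EN]
    [NormedSpace ℝ EN] (S : Set M) [ChartedSpace EN S] : Prop where
  isManifold : IsManifold 𝓘(ℝ, EN) ∞ S
  isSmoothEmbedding : Manifold.IsSmoothEmbedding 𝓘(ℝ, EN) I ∞ (Subtype.val : S → M)

end Generalities

section Cocycle

variable {EG : Type*} [NormedAddCommGroup EG] [NormedSpace ℝ EG]
  {G : Type*} [TopologicalSpace G] [ChartedSpace EG G] [Group G]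
  {P : Type*} [MulAction Gᵐᵒᵖ P]

/-- The value `δ(p g⁻¹) - Ad*_{g⁻¹} δ(p)` at `g` of the `1`-cocycle `σ_δ : G → 𝔤*`. It does not
depend on `p` if `P` is connected and `δ` is a `B𝔤`-potential of an invariant closed form. -/
def cocycle (δ : P → EG →L[ℝ] ℝ) (p : P) (g : G) : EG →L[ℝ] ℝ :=
  δ (op g⁻¹ • p) - coAd g⁻¹ (δ p)

theorem Ad_one : Ad EG (1 : G) = ContinuousLinearMap.id ℝ EG := by
  have h : (fun h : G => (1 : G) * h * (1 : G)⁻¹) = id := by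
    funext h; simp
  unfold Ad
  rw [h, mfderiv_id]
  rfl

theorem Ad_mul [LieGroup 𝓘(ℝ, EG) ∞ G] (g h : G) :
    Ad EG (g * h) = (Ad EG g).comp (Ad EG h) := by
  have hd : ∀ g : G, ContMDiff 𝓘(ℝ, EG) 𝓘(ℝ, EG) ∞ (fun k : G => g * k * g⁻¹) := fun g =>
    (contMDiff_const.mul contMDiff_id).mul contMDiff_const
  have hc : (fun k : G => g * h * k * (g * h)⁻¹) =
      (fun k : G => g * k * g⁻¹) ∘ (fun k : G => h * k * h⁻¹) := by
    funext k; simp [mul_assoc]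
  have h1 : h * 1 * h⁻¹ = 1 := by simp
  have key := mfderiv_comp (I := 𝓘(ℝ, EG)) (I' := 𝓘(ℝ, EG)) (I'' := 𝓘(ℝ, EG)) (1 : G)
    ((hd g).mdifferentiable (by simp) (h * 1 * h⁻¹)) ((hd h).mdifferentiable (by simp) 1)
  unfold Ad
  rw [hc]
  refine key.trans ?_
  rw [h1]
  rfl

theorem coAd_one (μ : EG →L[ℝ] ℝ) : coAd (1 : G) μ = μ := by
  simp [coAd, Ad_one]

theorem coAd_mul [LieGroup 𝓘(ℝ, EG) ∞ G] (g h : G) (μ : EG →L[ℝ] ℝ) :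
    coAd (g * h) μ = coAd h (coAd g μ) := by
  simp [coAd, Ad_mul, ContinuousLinearMap.comp_assoc]

theorem coAd_add (g : G) (μ ν : EG →L[ℝ] ℝ) : coAd g (μ + ν) = coAd g μ + coAd g ν := by
  simp [coAd, ContinuousLinearMap.add_comp]

theorem fixed_iff (δ : P → EG →L[ℝ] ℝ) (μ : EG →L[ℝ] ℝ) (p : P) (g : G) :
    coAd g μ - cocycle δ p g⁻¹ = μ ↔ coAd g (μ + δ p) = μ + δ (op g • p) := by
  simp only [cocycle, inv_inv, coAd_add]
  constructor <;> intro h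
  · rw [← sub_eq_zero] at h ⊢
    rw [← h]; abel
  · rw [← sub_eq_zero] at h ⊢
    rw [← h]; abel

/-- The isotropy group `G_μ` of `μ` for the affine action `(g, μ) ↦ Ad*_g μ - σ_δ(g⁻¹)` of `G` on
`𝔤*` with `1`-cocycle `-σ_δ`. -/
def isotropy (G : Type*) [TopologicalSpace G] [ChartedSpace EG G] [Group G]
    [LieGroup 𝓘(ℝ, EG) ∞ G] [MulAction Gᵐᵒᵖ P] (δ : P → EG →L[ℝ] ℝ) (μ : EG →L[ℝ] ℝ) :
    Subgroup G where
  carrier := {g | ∀ p : P, coAd g μ - cocycle δ p g⁻¹ = μ}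
  one_mem' := fun p => by
    rw [fixed_iff]; simp [coAd_one]
  mul_mem' := fun {g h} hg hh p => by
    have h1 := (fixed_iff δ μ p g).1 (hg p)
    have h2 := (fixed_iff δ μ (op g • p) h).1 (hh (op g • p))
    rw [fixed_iff, coAd_mul, h1, h2, op_mul, mul_smul]
  inv_mem' := fun {g} hg p => by
    have h1 := (fixed_iff δ μ (op g⁻¹ • p) g).1 (hg (op g⁻¹ • p))
    rw [← mul_smul, ← op_mul, inv_mul_cancel, op_one, one_smul] at h1
    rw [fixed_iff, ← h1, ← coAd_mul, mul_inv_cancel, coAd_one]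

end Cocycle

section FibredTangent

variable {EQ : Type*} [NormedAddCommGroup EQ] [NormedSpace ℝ EQ]
  {Q : Type*} [TopologicalSpace Q] [ChartedSpace EQ Q]
  {P : Type*} [TopologicalSpace P]

variable (EQ) in
/-- The fibred product `T_P Q = TQ ×_Q P` along `ε : P → Q`, as the total space of the pullback
bundle `ε^* TQ` over `P`: a point is a pair `⟨p, v⟩` with `p : P` and `v ∈ T_{ε p} Q`. Topology
and charts are those that Mathlib puts on a pullback of a vector bundle. -/
abbrev FibredTangent (ε : C(P, Q)) : Type _ :=
  TotalSpace EQ ((ε : P → Q) *ᵖ (TangentSpace 𝓘(ℝ, EQ) : Q → Type _))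

variable (EQ) in
/-- The point `(v, p)` of `T_P Q`. -/
def FibredTangent.mk (ε : C(P, Q)) (p : P) (v : TangentSpace 𝓘(ℝ, EQ) (ε p)) :
    FibredTangent EQ ε := ⟨p, v⟩

/-- The velocity component `v ∈ T_{ε p} Q` of the point `(v, p)` of `T_P Q`. -/
def FibredTangent.vel {ε : C(P, Q)} (z : FibredTangent EQ ε) :
    TangentSpace 𝓘(ℝ, EQ) (ε z.proj) := z.snd

end FibredTangent

section System

variable {EG : Type*} [NormedAddCommGroup EG] [NormedSpace ℝ EG]
  {G : Type*} [TopologicalSpace G] [ChartedSpace EG G] [Group G]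
  {EQ : Type*} [NormedAddCommGroup EQ] [NormedSpace ℝ EQ]
  {Q : Type*} [TopologicalSpace Q] [ChartedSpace EQ Q] [MulAction Gᵐᵒᵖ Q]
  {EP : Type*} [NormedAddCommGroup EP] [NormedSpace ℝ EP]
  {P : Type*} [TopologicalSpace P] [ChartedSpace EP P] [MulAction Gᵐᵒᵖ P]

/-- `ε (p g) = (ε p) g`: the map `ε` intertwines the two right actions of `G`. -/
def Equivariant (G : Type*) [Group G] [MulAction Gᵐᵒᵖ Q] [MulAction Gᵐᵒᵖ P] (ε : C(P, Q)) :
    Prop :=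
  ∀ (g : G) (p : P), ε (op g • p) = op g • ε p

/-- The lifted action `(v, p) ↦ (TΨ_g v, p g)` on `T_P Q`; the vector `TΨ_g v` is tangent at
`(ε p) g = ε (p g)`. -/
def liftedAct {ε : C(P, Q)} (hε : Equivariant G ε) (g : G) (z : FibredTangent EQ ε) :
    FibredTangent EQ ε :=
  FibredTangent.mk EQ ε (op g • z.proj)
    (cast (congrArg (TangentSpace 𝓘(ℝ, EQ)) (hε g z.proj).symm)
      (mfderiv 𝓘(ℝ, EQ) 𝓘(ℝ, EQ) (fun q : Q => op g • q) (ε z.proj) z.vel))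

/-- The fibre derivative `𝔽L(v, p) ∈ T*_{ε p} Q`,
`⟨𝔽L(v, p), w⟩ = d/du|_{u=0} L(v + u w, p)`. -/
def fibreDeriv {ε : C(P, Q)} (L : FibredTangent EQ ε → ℝ) (p : P)
    (v : TangentSpace 𝓘(ℝ, EQ) (ε p)) : TangentSpace 𝓘(ℝ, EQ) (ε p) →L[ℝ] ℝ :=
  (fderiv ℝ (fun w : EQ => L (FibredTangent.mk EQ ε p w)) v : EQ →L[ℝ] ℝ)

/-- The momentum map `J_{L,δ}`, `⟨J_{L,δ}(v, p), ξ⟩ = ⟨𝔽L(v, p), ξ_Q(ε p)⟩ - ⟨δ(p), ξ⟩`. -/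
def momentum (G : Type*) [TopologicalSpace G] [ChartedSpace EG G] [Group G] [MulAction Gᵐᵒᵖ Q]
    {ε : C(P, Q)} (L : FibredTangent EQ ε → ℝ) (δ : P → EG →L[ℝ] ℝ)
    (z : FibredTangent EQ ε) : EG →L[ℝ] ℝ :=
  (fibreDeriv L z.proj z.vel).comp (infAction EG EQ G (ε z.proj)) - δ z.proj

/-- The smooth `𝔤*`-valued function `δ` on `P` is a `B𝔤`-potential: `i_{ξ_P} B = d δ_ξ` for all
`ξ ∈ 𝔤`, where `δ_ξ(p) = ⟨δ(p), ξ⟩`. -/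
structure IsPotential (G : Type*) [TopologicalSpace G] [ChartedSpace EG G] [Group G]
    [MulAction Gᵐᵒᵖ P] (B : TwoForm EP P) (δ : P → EG →L[ℝ] ℝ) : Prop where
  smooth : ContMDiff 𝓘(ℝ, EP) 𝓘(ℝ, EG →L[ℝ] ℝ) ∞ δ
  potential : ∀ (ξ : EG) (p : P) (w : TangentSpace 𝓘(ℝ, EP) p),
    B p ![infAction EG EP G p ξ, w] = mfderiv 𝓘(ℝ, EP) 𝓘(ℝ, ℝ) (fun p' => δ p' ξ) p w

/-- The Lagrangian is `G`-regular: for every `(v, p)`, the map `ξ ↦ J_{L,δ}(v + ξ_Q(ε p), p)` is a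
diffeomorphism from `𝔤` onto `𝔤*`. -/
def IsGRegular (G : Type*) [TopologicalSpace G] [ChartedSpace EG G] [Group G] [MulAction Gᵐᵒᵖ Q]
    {ε : C(P, Q)} (L : FibredTangent EQ ε → ℝ) (δ : P → EG →L[ℝ] ℝ) : Prop :=
  ∀ (p : P) (v : TangentSpace 𝓘(ℝ, EQ) (ε p)),
    ∃ Φ : Diffeomorph 𝓘(ℝ, EG) 𝓘(ℝ, EG →L[ℝ] ℝ) EG (EG →L[ℝ] ℝ) ∞,
      ∀ ξ, Φ ξ = momentum G L δ (FibredTangent.mk EQ ε p (v + infAction EG EQ G (ε p) ξ))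

/-- The level set `J_{L,δ}⁻¹(μ)`. -/
def levelSet (G : Type*) [TopologicalSpace G] [ChartedSpace EG G] [Group G] [MulAction Gᵐᵒᵖ Q]
    {ε : C(P, Q)} (L : FibredTangent EQ ε → ℝ) (δ : P → EG →L[ℝ] ℝ) (μ : EG →L[ℝ] ℝ) :
    Set (FibredTangent EQ ε) :=
  {z | momentum G L δ z = μ}

theorem mdifferentiable_act (hQ : IsSmoothFreeProper EG G EQ Q) (g : G) :
    MDifferentiable 𝓘(ℝ, EQ) 𝓘(ℝ, EQ) (fun q : Q => op g • q) :=
  (hQ.smooth.comp (contMDiff_id.prodMk contMDiff_const) :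
    ContMDiff 𝓘(ℝ, EQ) 𝓘(ℝ, EQ) ∞ (fun q : Q => op g • q)).mdifferentiable (by simp)

theorem liftedAct_snd {ε : C(P, Q)} (hε : Equivariant G ε) (g : G) (z : FibredTangent EQ ε) :
    HEq (liftedAct hε g z).snd
      (mfderiv 𝓘(ℝ, EQ) 𝓘(ℝ, EQ) (fun q : Q => op g • q) (ε z.proj) z.vel) := by
  have h := cast_heq (congrArg (TangentSpace 𝓘(ℝ, EQ)) (hε g z.proj).symm)
    (mfderiv 𝓘(ℝ, EQ) 𝓘(ℝ, EQ) (fun q : Q => op g • q) (ε z.proj) z.vel)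
  exact h

theorem liftedAct_one {ε : C(P, Q)} (hε : Equivariant G ε) (z : FibredTangent EQ ε) :
    liftedAct hε 1 z = z := by
  obtain ⟨p, v⟩ := z
  refine TotalSpace.ext (one_smul _ p) ?_
  refine (liftedAct_snd hε _ _).trans ?_
  have h : (fun q : Q => op (1 : G) • q) = id := by funext q; simp
  rw [h, mfderiv_id]
  rfl

theorem liftedAct_mul (hQ : IsSmoothFreeProper EG G EQ Q) {ε : C(P, Q)} (hε : Equivariant G ε)
    (g h : G) (z : FibredTangent EQ ε) :
    liftedAct hε (g * h) z = liftedAct hε h (liftedAct hε g z) := by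
  obtain ⟨p, v⟩ := z
  refine TotalSpace.ext (by simp [liftedAct, FibredTangent.mk, mul_smul]) ?_
  refine (liftedAct_snd hε _ _).trans (HEq.trans ?_ (liftedAct_snd hε _ _).symm)
  have hc : (fun q : Q => op (g * h) • q) = (fun q : Q => op h • q) ∘ (fun q : Q => op g • q) := by
    funext q; simp [mul_smul]
  have key := mfderiv_comp (I := 𝓘(ℝ, EQ)) (I' := 𝓘(ℝ, EQ)) (I'' := 𝓘(ℝ, EQ)) (ε p)
    (mdifferentiable_act hQ h (op g • ε p)) (mdifferentiable_act hQ g (ε p))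
  have h1 : ∀ (q : Q) (hq : q = op g • ε p) (w : TangentSpace 𝓘(ℝ, EQ) q),
      HEq w (mfderiv 𝓘(ℝ, EQ) 𝓘(ℝ, EQ) (fun q : Q => op g • q) (ε p) v) →
      HEq (mfderiv 𝓘(ℝ, EQ) 𝓘(ℝ, EQ) (fun q : Q => op (g * h) • q) (ε p) v)
        (mfderiv 𝓘(ℝ, EQ) 𝓘(ℝ, EQ) (fun q : Q => op h • q) q w) := by
    rintro q rfl w hw
    rw [hc, eq_of_heq hw]
    exact heq_of_eq (congrArg (fun A => A v) key)
  exact h1 (ε (op g • p)) (hε g p) _ (liftedAct_snd hε g ⟨p, v⟩)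

/-- The orbit relation of the lifted action of the subgroup `K` of `G`, restricted to a subset `S`
of `T_P Q`. -/
def orbitSetoid (hQ : IsSmoothFreeProper EG G EQ Q) {ε : C(P, Q)} (hε : Equivariant G ε)
    (K : Subgroup G) (S : Set (FibredTangent EQ ε)) : Setoid S where
  r z z' := ∃ g ∈ K, (z' : FibredTangent EQ ε) = liftedAct hε g z
  iseqv :=
    { refl := fun z => ⟨1, K.one_mem, (liftedAct_one hε _).symm⟩
      symm := fun {z z'} ⟨g, hg, h⟩ => ⟨g⁻¹, K.inv_mem hg, by
        rw [h, ← liftedAct_mul hQ, mul_inv_cancel, liftedAct_one]⟩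
      trans := fun {z z' z''} ⟨g, hg, h⟩ ⟨g', hg', h'⟩ => ⟨g * g', K.mul_mem hg hg', by
        rw [h', h, liftedAct_mul hQ]⟩ }

/-- The map `P/K → Q/G`, `[p]_K ↦ [ε p]_G`, for a subgroup `K` of `G`. -/
def reducedMap {ε : C(P, Q)} (hε : Equivariant G ε) (K : Subgroup G) :
    C(MulAction.orbitRel.Quotient K.op P, MulAction.orbitRel.Quotient Gᵐᵒᵖ Q) where
  toFun := Quotient.lift (fun p => Quotient.mk (MulAction.orbitRel Gᵐᵒᵖ Q) (ε p)) (by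
    rintro p p' ⟨g, rfl⟩
    refine Quotient.sound ⟨g.1, ?_⟩
    exact (hε (unop g.1) p').symm)
  continuous_toFun := Continuous.quotient_lift (continuous_quotient_mk'.comp ε.continuous) _

end System

end

end MagneticRouth

open MagneticRouth

/-! The proof rests on one diffeomorphism, obtained from `G`-regularity: `D : T_P Q → T_P (Q/G) ×
𝔤*`, `(v, p) ↦ ((Tπ v, p), J(v, p))`. It is bijective because vectors at `ε p` with the same image
under `Tπ` differ by some `ξ_Q`, and `ξ ↦ J(v + ξ_Q, p)` is a bijection onto `𝔤*`. Its derivative is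
injective: a kernel vector is vertical over `P`, then is some `ξ_Q` because `Tπ` kills it, and then
`ξ = 0` because `ξ ↦ J(v + ξ_Q, p)` is a diffeomorphism. As `dim Q = dim Q/G + dim G`, the
derivative is bijective and the inverse function theorem applies
(`exists_equiv_tangentProj_momentum`).

In these coordinates `J⁻¹(μ)` is the slice `T_P (Q/G) × {μ}`, hence an embedded submanifold
diffeomorphic to `T_P (Q/G)`. From `J(z g) + δ(p g) = Ad*_g (J(z) + δ(p))` it follows that `G_μ`
preserves `J⁻¹(μ)`, and injectivity of `D` identifies the fibres of `f : J⁻¹(μ) → T_{P/G_μ} (Q/G)`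
with the orbits of `G_μ` (`exists_eq_liftedAct`). Local sections of `P → P/G_μ` give local sections
of `f`. So `f` is a surjective submersion, and `J⁻¹(μ)/G_μ` is diffeomorphic to its target.

That `ker Tπ` consists of the `ξ_Q` is a dimension count. The generators lie in the kernel, and
`G`-regularity makes `ξ ↦ ξ_Q` injective. Conversely, the fibres of `π` are orbits, that is, smooth
images of `G`, so by Hausdorff dimension they have dimension at most `dim G`
(`finrank_le_of_isQuotientManifold`). -/

namespace MagneticRouth
open Set Filter Topology Manifold

/-! ### Inverse function theorem, immersions, submersions and transport of smooth structures -/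

section DifferentialTopology

variable {E : Type*} [NormedAddCommGroup E] [NormedSpace ℝ E]
  {H : Type*} [TopologicalSpace H] {I : ModelWithCorners ℝ E H}
  {M : Type*} [TopologicalSpace M] [ChartedSpace H M]
  {E' : Type*} [NormedAddCommGroup E'] [NormedSpace ℝ E']
  {H' : Type*} [TopologicalSpace H'] {J : ModelWithCorners ℝ E' H'}
  {N : Type*} [TopologicalSpace N] [ChartedSpace H' N]

/-- The inverse function theorem for maps to a normed space, on an open set. -/
theorem exists_openPartialHomeomorph_of_contDiffOn [CompleteSpace E] {f : E → E'} {U : Set E}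
    (hU : IsOpen U) {a : E} (ha : a ∈ U) (hf : ContDiffOn ℝ ∞ f U) (f' : E ≃L[ℝ] E')
    (hf' : HasFDerivAt f (f' : E →L[ℝ] E') a) :
    ∃ e : OpenPartialHomeomorph E E', a ∈ e.source ∧ e.source ⊆ U ∧ EqOn e f e.source ∧
      ContDiffOn ℝ ∞ e.symm e.target := by
  have hfa : ContDiffAt ℝ ∞ f a := hf.contDiffAt (hU.mem_nhds ha)
  let A := hfa.toOpenPartialHomeomorph f hf' (by simp)
  -- The local inverse is smooth wherever the derivative of `f` is invertible. This is an open
  -- condition, so the source is shrunk to it.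
  let V : Set E := U ∩ (fderiv ℝ f) ⁻¹' (range ((↑) : (E ≃L[ℝ] E') → E →L[ℝ] E'))
  have hV : IsOpen V :=
    (hf.continuousOn_fderiv_of_isOpen hU (by simp)).isOpen_inter_preimage hU
      ContinuousLinearEquiv.isOpen
  have haV : a ∈ V := ⟨ha, f', hf'.fderiv.symm⟩
  refine ⟨A.restrOpen V hV, ⟨hfa.mem_toOpenPartialHomeomorph_source hf' _, haV⟩,
    fun x hx => hx.2.1, fun x hx => rfl, fun y hy => ContDiffAt.contDiffWithinAt ?_⟩
  have hy' := (A.restrOpen V hV).map_target hy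
  obtain ⟨g', hg'⟩ := hy'.2.2
  have hfy : ContDiffAt ℝ ∞ f ((A.restrOpen V hV).symm y) :=
    hf.contDiffAt (hU.mem_nhds hy'.2.1)
  refine (A.restrOpen V hV).contDiffAt_symm hy (f₀' := g') ?_ hfy
  rw [hg']
  exact (hfy.differentiableAt (by simp)).hasFDerivAt

/-- A smooth map to the model space whose derivative at `x` is invertible is, near `x`, a chart. -/
theorem exists_chart_of_hasFDerivAt [I.Boundaryless] [CompleteSpace E] [IsManifold I ∞ M]
    {g : M → E} {U : Set M} (hU : IsOpen U) {x : M} (hx : x ∈ U)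
    (hg : ContMDiffOn I 𝓘(ℝ, E) ∞ g U) (g' : E ≃L[ℝ] E)
    (hg' : HasFDerivAt (g ∘ (extChartAt I x).symm) (g' : E →L[ℝ] E) (extChartAt I x x)) :
    ∃ e ∈ IsManifold.maximalAtlas I ∞ M, x ∈ e.source ∧ e.source ⊆ U ∧
      ∀ y ∈ e.source, I (e y) = g y := by
  have hI : ∀ v, I (I.symm v) = v := fun v => I.right_inv (by simp [I.range_eq_univ])
  let c := chartAt H x
  -- Without boundary `I` is a homeomorphism, so the extended chart is an open partial homeomorphism
  -- onto an open subset of `E`.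
  let φ : OpenPartialHomeomorph M E := c.trans I.toHomeomorph.toOpenPartialHomeomorph
  have hφs : φ.source = c.source := by simp [φ]
  have hφt : φ.target = I.symm ⁻¹' c.target := by
    ext v; simp [φ]
  have hφ : ∀ y, φ y = extChartAt I x y := fun y => rfl
  have hφsymm : ∀ y, φ.symm y = (extChartAt I x).symm y := fun y => rfl
  have hφsm : ContMDiffOn I 𝓘(ℝ, E) ∞ φ φ.source := by
    rw [hφs]; exact contMDiffOn_extChartAt
  have htar : φ.target = (extChartAt I x).target := by
    rw [hφt, extChartAt_target, I.range_eq_univ, inter_univ]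
  have hφsm' : ContMDiffOn 𝓘(ℝ, E) I ∞ φ.symm φ.target := by
    rw [htar]; exact contMDiffOn_extChartAt_symm x
  let U' : Set E := φ.target ∩ φ.symm ⁻¹' U
  have hU' : IsOpen U' := φ.isOpen_inter_preimage_symm hU
  have hxs : x ∈ φ.source := by rw [hφs]; exact mem_chart_source H x
  have hxU' : φ x ∈ U' := ⟨φ.map_source hxs, by simpa [φ.left_inv hxs] using hx⟩
  have hG : ContDiffOn ℝ ∞ (g ∘ φ.symm) U' := by
    rw [← contMDiffOn_iff_contDiffOn]
    exact hg.comp (hφsm'.mono inter_subset_left) fun v hv => hv.2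
  obtain ⟨A, hA, hAU, hAe, hAs⟩ := exists_openPartialHomeomorph_of_contDiffOn hU' hxU' hG g' hg'
  have hAsm : ContDiffOn ℝ ∞ A A.source := (hG.mono hAU).congr hAe
  let e := (φ.trans A).trans I.toHomeomorph.symm.toOpenPartialHomeomorph
  have hes : ∀ y, y ∈ e.source ↔ y ∈ φ.source ∧ φ y ∈ A.source := fun y => by
    simp [e]
  have hee : ∀ y, e y = I.symm (A (φ y)) := fun y => rfl
  have het : ∀ h, h ∈ e.target ↔ I h ∈ A.target ∧ A.symm (I h) ∈ φ.target := fun h => by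
    simp [e]
  have hIsymm : ContMDiff 𝓘(ℝ, E) I ∞ I.symm := by
    have := I.contMDiffOn_symm (n := ∞)
    rwa [I.range_eq_univ, contMDiffOn_univ] at this
  refine ⟨e, e.mem_maximalAtlas_of_contMDiffOn ?_ ?_, (hes x).2 ⟨hxs, hA⟩, ?_, ?_⟩
  · refine hIsymm.comp_contMDiffOn ?_
    exact (contMDiffOn_iff_contDiffOn.2 hAsm).comp (hφsm.mono fun y hy => ((hes y).1 hy).1)
      fun y hy => ((hes y).1 hy).2
  · refine hφsm'.comp (t := φ.target) ?_ fun h hh => ((het h).1 hh).2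
    exact (contMDiffOn_iff_contDiffOn.2 hAs).comp I.contMDiff.contMDiffOn
      fun h hh => ((het h).1 hh).1
  · intro y hy
    have := (hAU ((hes y).1 hy).2).2
    rwa [mem_preimage, φ.left_inv ((hes y).1 hy).1] at this
  · intro y hy
    rw [hee, hI, hAe ((hes y).1 hy).2, Function.comp_apply, φ.left_inv ((hes y).1 hy).1]

/-- Without boundary the model has full range, so the derivative within the range that defines
`mfderiv` is an ordinary Fréchet derivative. -/
theorem hasFDerivAt_written [I.Boundaryless] {f : M → N} {x : M}
    (hf : MDifferentiableAt I J f x) :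
    HasFDerivAt (extChartAt J (f x) ∘ f ∘ (extChartAt I x).symm) (mfderiv I J f x : E →L[ℝ] E')
      (extChartAt I x x) := by
  have := hf.hasMFDerivAt.2
  rw [I.range_eq_univ] at this
  exact hasFDerivWithinAt_univ.1 this

/-- A surjective linear map is the first component of an isomorphism onto a product. -/
theorem exists_prod_equiv_of_surjective [FiniteDimensional ℝ E] [FiniteDimensional ℝ E']
    (A : E →L[ℝ] E') (hA : Function.Surjective A) :
    ∃ e : E ≃L[ℝ] E' × (Fin (Module.finrank ℝ E - Module.finrank ℝ E') → ℝ),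
      ∀ v, (e v).1 = A v := by
  let K := A.toLinearMap.ker
  -- A linear projection onto the kernel supplies the coordinates that `A` forgets.
  obtain ⟨P, hP⟩ := K.subtype.exists_leftInverse_of_injective (by simp)
  have hrank := A.toLinearMap.finrank_range_add_finrank_ker
  have hr : A.toLinearMap.range = ⊤ := LinearMap.range_eq_top.2 hA
  rw [hr, finrank_top] at hrank
  have hK : Module.finrank ℝ K =
      Module.finrank ℝ (Fin (Module.finrank ℝ E - Module.finrank ℝ E') → ℝ) := by
    simp only [Module.finrank_fin_fun, K]; omega
  let κ : K ≃ₗ[ℝ] (Fin (Module.finrank ℝ E - Module.finrank ℝ E') → ℝ) :=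
    LinearEquiv.ofFinrankEq _ _ hK
  let T : E →ₗ[ℝ] E' × (Fin (Module.finrank ℝ E - Module.finrank ℝ E') → ℝ) :=
    A.toLinearMap.prod (κ.toLinearMap.comp P)
  have hT : Function.Injective T := by
    rw [← LinearMap.ker_eq_bot, LinearMap.ker_eq_bot']
    intro v hv
    have h1 : A v = 0 := congrArg Prod.fst hv
    have h2 : κ (P v) = 0 := congrArg Prod.snd hv
    have h3 : P v = ⟨v, h1⟩ := LinearMap.congr_fun hP ⟨v, h1⟩
    rw [h3] at h2
    exact congrArg Subtype.val (κ.map_eq_zero_iff.1 h2)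
  have hdim : Module.finrank ℝ E = Module.finrank ℝ
      (E' × (Fin (Module.finrank ℝ E - Module.finrank ℝ E') → ℝ)) := by
    simp only [Module.finrank_prod, Module.finrank_fin_fun]; omega
  exact ⟨(T.linearEquivOfInjective hT hdim).toContinuousLinearEquiv, fun v => rfl⟩

/-- A linear map `R` with right inverse `A` is the first component of an isomorphism onto a product
whose second component vanishes on the range of `A`. -/
theorem exists_prod_equiv_of_leftInverse [FiniteDimensional ℝ E] [FiniteDimensional ℝ E']
    (A : E →L[ℝ] E') (R : E' →L[ℝ] E) (hRA : ∀ v, R (A v) = v) :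
    ∃ (C : E' →L[ℝ] (Fin (Module.finrank ℝ E' - Module.finrank ℝ E) → ℝ))
      (τ : E' ≃L[ℝ] E × (Fin (Module.finrank ℝ E' - Module.finrank ℝ E) → ℝ)),
      ∀ v, τ v = (R v, C (v - A (R v))) := by
  obtain ⟨eq, heq⟩ := exists_prod_equiv_of_surjective R fun v => ⟨A v, hRA v⟩
  let C : E' →L[ℝ] (Fin (Module.finrank ℝ E' - Module.finrank ℝ E) → ℝ) :=
    (ContinuousLinearMap.snd ℝ E _).comp (eq : E' →L[ℝ] E × _)
  -- Subtracting `A (R v)` makes the second component vanish on the range of `A`, which `C` alone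
  -- need not do.
  let T : E' →L[ℝ] E × (Fin (Module.finrank ℝ E' - Module.finrank ℝ E) → ℝ) :=
    R.prod (C.comp (ContinuousLinearMap.id ℝ E' - A.comp R))
  have hT : Function.Injective T.toLinearMap := by
    rw [← LinearMap.ker_eq_bot, LinearMap.ker_eq_bot']
    intro v hv
    have h1 : R v = 0 := congrArg Prod.fst hv
    have h2 : C (v - A (R v)) = 0 := congrArg Prod.snd hv
    rw [h1, map_zero, sub_zero] at h2
    exact eq.map_eq_zero_iff.1 (Prod.ext ((heq v).trans h1) h2)
  exact ⟨C, (T.toLinearMap.linearEquivOfInjective hT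
    eq.toLinearEquiv.finrank_eq).toContinuousLinearEquiv, fun v => rfl⟩

/-- A smooth bijection whose derivatives are all bijective has a smooth inverse. -/
theorem contMDiff_symm_of_bijective_mfderiv [I.Boundaryless]
    [FiniteDimensional ℝ E] [IsManifold I ∞ M] [IsManifold J ∞ N]
    (f : M ≃ N) (hf : ContMDiff I J ∞ f)
    (hf' : ∀ x, Function.Bijective (mfderiv I J f x)) : ContMDiff J I ∞ f.symm := by
  intro y
  obtain ⟨x, rfl⟩ := f.surjective y
  obtain ⟨A, hA, hAb⟩ : ∃ A : E →L[ℝ] E', HasFDerivAt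
      (extChartAt J (f x) ∘ f ∘ (extChartAt I x).symm) A (extChartAt I x x) ∧
      Function.Bijective A :=
    ⟨_, hasFDerivAt_written (hf.mdifferentiableAt (by simp)), hf' x⟩
  let θ : E ≃L[ℝ] E' :=
    (LinearEquiv.ofBijective A.toLinearMap hAb).toContinuousLinearEquiv
  let ψ := extChartAt J (f x)
  let U : Set M := f ⁻¹' (chartAt H' (f x)).source
  have hU : IsOpen U := (chartAt H' (f x)).open_source.preimage hf.continuous
  have hψ : ContMDiffOn J 𝓘(ℝ, E') ∞ ψ (chartAt H' (f x)).source := contMDiffOn_extChartAt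
  -- Since `θ⁻¹ ∘ ψ ∘ f` has the identity as derivative in the chart at `x`, it is itself a chart of
  -- `M`. In this chart `f` is the linear map `θ`, and the inverse can be written down.
  obtain ⟨e, he, hxe, heU, hee⟩ := exists_chart_of_hasFDerivAt (I := I)
    (g := fun y => θ.symm (ψ (f y))) hU (mem_chart_source H' (f x))
    (θ.symm.contDiff.contMDiff.comp_contMDiffOn
      (hψ.comp hf.contMDiffOn fun y hy => hy)) (ContinuousLinearEquiv.refl ℝ E) (by
      have := (θ.symm : E' →L[ℝ] E).hasFDerivAt.comp _ hA
      refine this.congr_fderiv ?_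
      ext v
      exact θ.symm_apply_apply v)
  let S : N → M := fun z => e.symm (I.symm (θ.symm (ψ z)))
  have hIsymm : ContMDiff 𝓘(ℝ, E) I ∞ I.symm := by
    have := I.contMDiffOn_symm (n := ∞)
    rwa [I.range_eq_univ, contMDiffOn_univ] at this
  have hψ' : ContMDiffAt J 𝓘(ℝ, E') ∞ ψ (f x) := contMDiffAt_extChartAt
  have hg : ContMDiffAt J I ∞ (fun z => I.symm (θ.symm (ψ z))) (f x) :=
    hIsymm.contMDiffAt.comp (f x) (θ.symm.contDiff.contMDiff.contMDiffAt.comp (f x) hψ')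
  have hgx : I.symm (θ.symm (ψ (f x))) = e x := by rw [← hee x hxe, I.left_inv]
  have hS : ContMDiffAt J I ∞ S (f x) := by
    refine ContMDiffAt.comp (f x) (?_ : ContMDiffAt I I ∞ e.symm _) hg
    rw [hgx]
    exact contMDiffAt_symm_of_mem_maximalAtlas he (e.map_source hxe)
  refine hS.congr_of_eventuallyEq ?_
  have h1 : ∀ᶠ z in 𝓝 (f x), I.symm (θ.symm (ψ z)) ∈ e.target := by
    refine hg.continuousAt.eventually_mem (e.open_target.mem_nhds ?_)
    rw [hgx]; exact e.map_source hxe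
  filter_upwards [h1, (chartAt H' (f x)).open_source.mem_nhds (mem_chart_source H' (f x))]
    with z hz hz'
  rw [Equiv.symm_apply_eq]
  have hSz : S z ∈ e.source := e.map_target hz
  have h2 := hee _ hSz
  have h3 : e (S z) = I.symm (θ.symm (ψ z)) := e.right_inv hz
  rw [h3, I.right_inv (by simp [I.range_eq_univ])] at h2
  have h4 : ψ z = ψ (f (S z)) := θ.symm.injective h2
  refine (extChartAt J (f x)).injOn ?_ ?_ h4
  · rwa [extChartAt_source]
  · rw [extChartAt_source]; exact heU hSz

/-- A smooth map between finite dimensional manifolds with surjective derivatives is a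
submersion. -/
theorem isSubmersion_of_surjective_mfderiv [I.Boundaryless]
    [FiniteDimensional ℝ E] [FiniteDimensional ℝ E'] [IsManifold I ∞ M] [IsManifold J ∞ N]
    {f : M → N} (hf : ContMDiff I J ∞ f)
    (hf' : ∀ x, Function.Surjective (mfderiv I J f x)) : IsSubmersion I J ∞ f := by
  refine IsSubmersionOfComplement.isSubmersion
    (F := Fin (Module.finrank ℝ E - Module.finrank ℝ E') → ℝ) fun x => ?_
  obtain ⟨A, hA, hAs⟩ : ∃ A : E →L[ℝ] E', HasFDerivAt
      (extChartAt J (f x) ∘ f ∘ (extChartAt I x).symm) A (extChartAt I x x) ∧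
      Function.Surjective A :=
    ⟨_, hasFDerivAt_written (hf.mdifferentiableAt (by simp)), hf' x⟩
  obtain ⟨eq, heq⟩ := exists_prod_equiv_of_surjective A hAs
  let ψ := extChartAt J (f x)
  let φ := extChartAt I x
  let C : E →L[ℝ] (Fin (Module.finrank ℝ E - Module.finrank ℝ E') → ℝ) :=
    (ContinuousLinearMap.snd ℝ E' _).comp (eq : E →L[ℝ] E' × _)
  let U : Set M := f ⁻¹' (chartAt H' (f x)).source ∩ (chartAt H x).source
  have hU : IsOpen U := ((chartAt H' (f x)).open_source.preimage hf.continuous).inter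
    (chartAt H x).open_source
  have hψ : ContMDiffOn J 𝓘(ℝ, E') ∞ ψ (chartAt H' (f x)).source := contMDiffOn_extChartAt
  have hφ : ContMDiffOn I 𝓘(ℝ, E) ∞ φ (chartAt H x).source := contMDiffOn_extChartAt
  have hid : HasFDerivAt (φ ∘ φ.symm) (ContinuousLinearMap.id ℝ E) (φ x) := by
    have := hasFDerivAt_written (I := I) (J := I) (f := id) (x := x) mdifferentiableAt_id
    rwa [mfderiv_id] at this
  -- The value of `f`, completed by the kernel coordinates of the point, serves as a chart, and in
  -- it `f` is the first projection.
  obtain ⟨e, he, hxe, heU, hee⟩ := exists_chart_of_hasFDerivAt (I := I)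
    (g := fun y => eq.symm (ψ (f y), C (φ y))) hU
    ⟨mem_chart_source H' (f x), mem_chart_source H x⟩
    (eq.symm.contDiff.contMDiff.comp_contMDiffOn
      ((hψ.comp hf.contMDiffOn fun y hy => hy.1).prodMk_space
        (C.contDiff.contMDiff.comp_contMDiffOn (hφ.mono inter_subset_right))))
      (ContinuousLinearEquiv.refl ℝ E) (by
      have h1 := hA.prodMk (C.hasFDerivAt.comp _ hid)
      have := (eq.symm : _ →L[ℝ] E).hasFDerivAt.comp _ h1
      refine this.congr_fderiv ?_
      ext v
      refine (eq.symm_apply_eq).2 (Prod.ext ?_ rfl)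
      exact (heq v).symm)
  refine IsSubmersionAtOfComplement.mk_of_charts eq e (chartAt H' (f x)) hxe
    (mem_chart_source _ _) he (IsManifold.chart_mem_maximalAtlas _) (fun y hy => (heU hy).1) ?_
  intro u hu
  have hu' : I.symm u ∈ e.target := by
    rw [OpenPartialHomeomorph.extend_target] at hu; exact hu.1
  have h2 := hee _ (e.map_target hu')
  rw [e.right_inv hu', I.right_inv (by simp [I.range_eq_univ])] at h2
  change ψ (f (e.symm (I.symm u))) = (eq u).1
  conv_rhs => rw [h2]
  simp

/-- A smooth map between finite dimensional manifolds with a smooth left inverse is an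
immersion. -/
theorem isImmersion_of_leftInverse [I.Boundaryless] [J.Boundaryless]
    [FiniteDimensional ℝ E] [FiniteDimensional ℝ E'] [IsManifold I ∞ M] [IsManifold J ∞ N]
    {f : M → N} (hf : ContMDiff I J ∞ f) {r : N → M} (hr : ContMDiff J I ∞ r)
    (hrf : Function.LeftInverse r f) : IsImmersion I J ∞ f := by
  refine IsImmersionOfComplement.isImmersion
    (F := Fin (Module.finrank ℝ E' - Module.finrank ℝ E) → ℝ) fun x => ?_
  let ψ := extChartAt J (f x)
  let φ := extChartAt I x
  let F := ψ ∘ f ∘ φ.symm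
  have hψ : ContMDiffOn J 𝓘(ℝ, E') ∞ ψ (chartAt H' (f x)).source := contMDiffOn_extChartAt
  have hφ : ContMDiffOn I 𝓘(ℝ, E) ∞ φ (chartAt H x).source := contMDiffOn_extChartAt
  obtain ⟨A, hA⟩ : ∃ A : E →L[ℝ] E', HasFDerivAt F A (φ x) :=
    ⟨_, hasFDerivAt_written (hf.mdifferentiableAt (by simp))⟩
  obtain ⟨R, hR⟩ : ∃ R : E' →L[ℝ] E, HasFDerivAt (φ ∘ r ∘ ψ.symm) R (ψ (f x)) := by
    have := hasFDerivAt_written (hr.mdifferentiableAt (by simp) : MDifferentiableAt J I r (f x))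
    obtain ⟨R, hR⟩ : ∃ R : E' →L[ℝ] E,
      HasFDerivAt (extChartAt I (r (f x)) ∘ r ∘ ψ.symm) R (ψ (f x)) := ⟨_, this⟩
    rw [hrf x] at hR
    exact ⟨R, hR⟩
  have hidN : HasFDerivAt (ψ ∘ ψ.symm) (ContinuousLinearMap.id ℝ E') (ψ (f x)) := by
    have := hasFDerivAt_written (I := J) (J := J) (f := id) (x := f x) mdifferentiableAt_id
    rwa [mfderiv_id] at this
  have hidM : HasFDerivAt (φ ∘ φ.symm) (ContinuousLinearMap.id ℝ E) (φ x) := by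
    have := hasFDerivAt_written (I := I) (J := I) (f := id) (x := x) mdifferentiableAt_id
    rwa [mfderiv_id] at this
  have hφx : φ.symm (φ x) = x := extChartAt_to_inv x
  have hψx : ψ.symm (ψ (f x)) = f x := extChartAt_to_inv (f x)
  have hFx : F (φ x) = ψ (f x) := by simp [F, hφx]
  have hRx : (φ ∘ r ∘ ψ.symm) (ψ (f x)) = φ x := by simp [hψx, hrf x]
  have hcφ : ContinuousAt φ.symm (φ x) := continuousAt_extChartAt_symm x
  -- The chain rule for `r ∘ f = id`, read in charts.
  have hRA : R.comp A = ContinuousLinearMap.id ℝ E := by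
    rw [← hFx] at hR
    refine (hR.comp (φ x) hA).unique (hidM.congr_of_eventuallyEq ?_)
    have : ∀ᶠ u in 𝓝 (φ x), f (φ.symm u) ∈ ψ.source := by
      refine (hf.continuous.continuousAt.comp hcφ).eventually_mem ?_
      simp only [Function.comp_apply, hφx]
      exact extChartAt_source_mem_nhds (f x)
    filter_upwards [this] with u hu
    simp only [F, Function.comp_apply]
    rw [ψ.left_inv hu, hrf]
  have hRA' : ∀ v, R (A v) = v := fun v => DFunLike.congr_fun hRA v
  obtain ⟨C, τ, hτ⟩ := exists_prod_equiv_of_leftInverse A R hRA'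
  let U : Set N := (chartAt H' (f x)).source ∩ (r ⁻¹' (φ.source ∩ f ⁻¹' (chartAt H' (f x)).source))
  have hU : IsOpen U := (chartAt H' (f x)).open_source.inter
    (((isOpen_extChartAt_source x).inter
      ((chartAt H' (f x)).open_source.preimage hf.continuous)).preimage hr.continuous)
  have hxU : f x ∈ U := by
    refine ⟨mem_chart_source _ _, ?_⟩
    simp only [mem_preimage, hrf x]
    exact ⟨mem_extChartAt_source x, mem_chart_source _ _⟩
  have hφr : ContMDiffOn J 𝓘(ℝ, E) ∞ (fun y => φ (r y)) U :=
    hφ.comp hr.contMDiffOn fun y hy => by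
      have := hy.2.1; rwa [extChartAt_source] at this
  have hψfr : ContMDiffOn J 𝓘(ℝ, E') ∞ (fun y => F (φ (r y))) U := by
    refine (hψ.comp (hf.comp hr).contMDiffOn fun y hy => hy.2.2).congr fun y hy => ?_
    simp only [F, Function.comp_apply]
    rw [φ.left_inv hy.2.1]
  -- The second component measures how far `y` is from `f (r y)`. It vanishes on the image of `f`,
  -- so in this chart `f` becomes `u ↦ (u, 0)`.
  obtain ⟨e, he, hxe, heU, hee⟩ := exists_chart_of_hasFDerivAt (I := J)
    (g := fun y => τ.symm (φ (r y), C (ψ y - F (φ (r y))))) hU hxU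
    (τ.symm.contDiff.contMDiff.comp_contMDiffOn
      (hφr.prodMk_space (C.contDiff.contMDiff.comp_contMDiffOn
        ((hψ.mono inter_subset_left).sub hψfr))))
      (ContinuousLinearEquiv.refl ℝ E') (by
      rw [← hRx] at hA
      have h1 := hR.prodMk (C.hasFDerivAt.comp _ (hidN.sub (hA.comp _ hR)))
      have := (τ.symm : _ →L[ℝ] E').hasFDerivAt.comp _ h1
      refine this.congr_fderiv ?_
      ext v
      exact (τ.symm_apply_eq).2 (hτ v).symm)
  have hV : IsOpen (f ⁻¹' e.source) := e.open_source.preimage hf.continuous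
  let d := (chartAt H x).restr (f ⁻¹' e.source)
  have hd : d ∈ IsManifold.maximalAtlas I ∞ M :=
    restr_mem_maximalAtlas _ (IsManifold.chart_mem_maximalAtlas x) hV
  have hds : d.source = (chartAt H x).source ∩ f ⁻¹' e.source :=
    (chartAt H x).restr_source' _ hV
  have hxd : x ∈ d.source := by rw [hds]; exact ⟨mem_chart_source H x, hxe⟩
  have hsub : d.source ⊆ f ⁻¹' e.source := by rw [hds]; exact inter_subset_right
  refine IsImmersionAtOfComplement.mk_of_charts τ.symm d e hxd hxe hd he hsub ?_
  intro u hu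
  rw [OpenPartialHomeomorph.extend_target] at hu
  have hu' : I.symm u ∈ d.target := hu.1
  have hy : d.symm (I.symm u) ∈ d.source := d.map_target hu'
  have hφy : φ (d.symm (I.symm u)) = u := by
    change I (d (d.symm (I.symm u))) = u
    rw [d.right_inv hu', I.right_inv hu.2]
  have hyφ : d.symm (I.symm u) ∈ φ.source := by
    rw [extChartAt_source]; exact (hds ▸ hy).1
  change J (e (f (d.symm (I.symm u)))) = τ.symm (u, 0)
  rw [hee _ (hsub hy), hrf, hφy]
  have : F u = ψ (f (d.symm (I.symm u))) := by
    rw [← hφy]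
    simp only [F, Function.comp_apply]
    rw [φ.left_inv hyφ, hφy]
  rw [this, sub_self, map_zero]

/-- A submersion has smooth local sections. -/
theorem exists_local_section [I.Boundaryless] {f : M → N} {x : M} (hf : IsSubmersionAt I J ∞ f x) :
    ∃ s : N → M, ContMDiffAt J I ∞ s (f x) ∧ s (f x) = x ∧ ∀ᶠ y in 𝓝 (f x), f (s y) = y := by
  have hI : ∀ v, I (I.symm v) = v := fun v => I.right_inv (by simp [I.range_eq_univ])
  have hIsymm : ContMDiff 𝓘(ℝ, E) I ∞ I.symm := by
    have := I.contMDiffOn_symm (n := ∞)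
    rwa [I.range_eq_univ, contMDiffOn_univ] at this
  let d := hf.domChart
  let c := hf.codChart
  have hx : x ∈ d.source := hf.mem_domChart_source
  have hfx : f x ∈ c.source := hf.mem_codChart_source
  -- In adapted charts `f` is the first projection. The section freezes the complementary coordinate
  -- at its value at `x`.
  let u : N → E := fun y => hf.equiv.symm (J (c y), (hf.equiv (I (d x))).2)
  have hwr : ∀ y ∈ d.source, J (c (f y)) = (hf.equiv (I (d y))).1 := fun y hy => by
    have hyt : I (d y) ∈ (d.extend I).target := (d.extend I).map_source (by simpa using hy)
    have := hf.writtenInCharts hyt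
    simpa [d.left_inv hy, d, c] using this
  have hux : I.symm (u (f x)) = d x := by
    have : (J (c (f x)), (hf.equiv (I (d x))).2) = hf.equiv (I (d x)) :=
      Prod.ext (hwr x hx) rfl
    simp [u, this]
  have hc : ContMDiffAt J J ∞ c (f x) :=
    contMDiffAt_of_mem_maximalAtlas hf.codChart_mem_maximalAtlas hfx
  have hu : ContMDiffAt J I ∞ (fun y => I.symm (u y)) (f x) :=
    hIsymm.contMDiffAt.comp _ (hf.equiv.symm.contDiff.contMDiff.contMDiffAt.comp _
      ((J.contMDiff.contMDiffAt.comp _ hc).prodMk_space contMDiffAt_const))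
  have hev : ∀ᶠ y in 𝓝 (f x), I.symm (u y) ∈ d.target := by
    refine hu.continuousAt.eventually_mem (d.open_target.mem_nhds ?_)
    rw [hux]; exact d.map_source hx
  refine ⟨fun y => d.symm (I.symm (u y)), ?_, ?_, ?_⟩
  · refine ContMDiffAt.comp (f x) (?_ : ContMDiffAt I I ∞ d.symm _) hu
    rw [hux]
    exact contMDiffAt_symm_of_mem_maximalAtlas hf.domChart_mem_maximalAtlas (d.map_source hx)
  · change d.symm (I.symm (u (f x))) = x
    rw [hux, d.left_inv hx]
  · filter_upwards [hev, c.open_source.mem_nhds hfx] with y hy hyc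
    have h1 := hwr _ (d.map_target hy)
    rw [d.right_inv hy, hI] at h1
    have h2 : J (c (f (d.symm (I.symm (u y))))) = J (c y) := by simpa [u] using h1
    exact c.injOn (hf.source_subset_preimage_source (d.map_target hy)) hyc (J.injective h2)

/-- Smooth structures can be transported along homeomorphisms. -/
theorem exists_chartedSpace_of_homeomorph [I.Boundaryless] [IsManifold I ∞ M]
    {X : Type*} [TopologicalSpace X] (h : X ≃ₜ M) (θ : E ≃L[ℝ] E') :
    ∃ _ : ChartedSpace E' X, IsManifold 𝓘(ℝ, E') ∞ X ∧ ContMDiff 𝓘(ℝ, E') I ∞ h ∧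
      ContMDiff I 𝓘(ℝ, E') ∞ h.symm := by
  -- The new charts are the old ones precomposed with `h` and followed by this change of model
  -- space.
  let T : H ≃ₜ E' := I.toHomeomorph.trans θ.toHomeomorph
  have hTs : ContMDiff I 𝓘(ℝ, E') ∞ T := θ.contDiff.contMDiff.comp I.contMDiff
  have hT : ∀ x, T x = θ (I x) := fun x => rfl
  have hTsymm : ∀ v, T.symm v = I.symm (θ.symm v) := fun x => rfl
  have hIsymm : ContMDiff 𝓘(ℝ, E) I ∞ I.symm := by
    have := I.contMDiffOn_symm (n := ∞)
    rwa [I.range_eq_univ, contMDiffOn_univ] at this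
  have hTs' : ContMDiff 𝓘(ℝ, E') I ∞ T.symm := hIsymm.comp θ.symm.contDiff.contMDiff
  let c : M → OpenPartialHomeomorph X E' := fun m =>
    (h.toOpenPartialHomeomorph.trans (chartAt H m)).trans T.toOpenPartialHomeomorph
  have hcs : ∀ m x, x ∈ (c m).source ↔ h x ∈ (chartAt H m).source := fun m x => by simp [c]
  have hct : ∀ m v, v ∈ (c m).target ↔ T.symm v ∈ (chartAt H m).target := fun m v => by simp [c]
  let cs : ChartedSpace E' X :=
    { atlas := range c
      chartAt := fun x => c (h x)
      mem_chart_source := fun x => (hcs _ _).2 (mem_chart_source H (h x))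
      chart_mem_atlas := fun x => mem_range_self _ }
  have hch : ∀ m : M, ContMDiffOn I I ∞ (chartAt H m : OpenPartialHomeomorph M H) (chartAt H m).source := fun m => contMDiffOn_chart
  have hch' : ∀ m : M, ContMDiffOn I I ∞ (chartAt H m).symm (chartAt H m).target :=
    fun m => contMDiffOn_chart_symm
  have hcc : ∀ m m', ContDiffOn ℝ ∞ ((c m).symm.trans (c m')) ((c m).symm.trans (c m')).source := by
    intro m m'
    rw [← contMDiffOn_iff_contDiffOn]
    have h1 : ContMDiffOn 𝓘(ℝ, E') 𝓘(ℝ, E') ∞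
        (fun v => T (chartAt H m' ((chartAt H m).symm (T.symm v))))
        ((c m).symm.trans (c m')).source := by
      refine hTs.comp_contMDiffOn ((hch m').comp ((hch' m).comp hTs'.contMDiffOn ?_) ?_)
      · intro v hv
        exact (hct m v).1 hv.1
      · intro v hv
        have := (hcs m' _).1 hv.2
        simpa [c] using this
    refine h1.congr fun v hv => ?_
    simp [c]
  have hm : IsManifold 𝓘(ℝ, E') ∞ X := by
    refine isManifold_of_contDiffOn _ _ _ ?_
    rintro _ _ ⟨m, rfl⟩ ⟨m', rfl⟩
    simpa using hcc m m'
  refine ⟨cs, hm, ?_, ?_⟩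
  · intro x
    have h1 : ContMDiffOn 𝓘(ℝ, E') I ∞ (fun y => (chartAt H (h x)).symm (T.symm (chartAt E' x y)))
        (chartAt E' x).source :=
      (hch' _).comp (hTs'.comp_contMDiffOn contMDiffOn_chart)
        fun y hy => (hct _ _).1 ((c (h x)).map_source hy)
    refine (h1.congr fun y hy => ?_).contMDiffAt ((chartAt E' x).open_source.mem_nhds
      (mem_chart_source E' x))
    change h y = (chartAt H (h x)).symm (T.symm (T (chartAt H (h x) (h y))))
    rw [T.symm_apply_apply, (chartAt H (h x)).left_inv ((hcs _ _).1 hy)]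
  · intro m
    obtain ⟨x, rfl⟩ := h.surjective m
    have h1 : ContMDiffOn I 𝓘(ℝ, E') ∞ (fun y => (chartAt E' x).symm (T (chartAt H (h x) y)))
        (chartAt H (h x)).source := by
      refine ContMDiffOn.comp (t := (chartAt E' x).target) contMDiffOn_chart_symm
        (hTs.comp_contMDiffOn (hch _)) fun y hy => (hct _ _).2 ?_
      rw [T.symm_apply_apply]
      exact (chartAt H (h x)).map_source hy
    refine (h1.congr fun y hy => ?_).contMDiffAt ((chartAt H (h x)).open_source.mem_nhds
      (mem_chart_source H (h x)))
    change h.symm y = h.symm ((chartAt H (h x)).symm (T.symm (T (chartAt H (h x) y))))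
    rw [T.symm_apply_apply, (chartAt H (h x)).left_inv hy]

end DifferentialTopology

/-! ### Consequences of local sections, and Hausdorff dimension of smooth images -/

section Submersions

variable {E : Type*} [NormedAddCommGroup E] [NormedSpace ℝ E]
  {H : Type*} [TopologicalSpace H] {I : ModelWithCorners ℝ E H}
  {M : Type*} [TopologicalSpace M] [ChartedSpace H M]
  {E' : Type*} [NormedAddCommGroup E'] [NormedSpace ℝ E']
  {H' : Type*} [TopologicalSpace H'] {J : ModelWithCorners ℝ E' H'}
  {N : Type*} [TopologicalSpace N] [ChartedSpace H' N]

/-- A map with a smooth local section has surjective derivative. -/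
theorem surjective_mfderiv_of_local_section {f : M → N} {x : M}
    (hf : MDifferentiableAt I J f x) {s : N → M} (hs : MDifferentiableAt J I s (f x))
    (hsx : s (f x) = x) (hfs : ∀ᶠ y in 𝓝 (f x), f (s y) = y) :
    Function.Surjective (mfderiv I J f x) := by
  have hf' : HasMFDerivAt I J f (s (f x)) (mfderiv I J f x : E →L[ℝ] E') := by
    rw [hsx]; exact hf.hasMFDerivAt
  have h1 := hf'.comp (f x) hs.hasMFDerivAt
  have h2 : HasMFDerivAt J J (f ∘ s) (f x) (ContinuousLinearMap.id ℝ (TangentSpace J (f x))) :=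
    (hasMFDerivAt_id (f x)).congr_of_eventuallyEq hfs
  have h3 := hasMFDerivAt_unique h1 h2
  exact fun w => ⟨mfderiv J I s (f x) w, DFunLike.congr_fun h3 w⟩

theorem surjective_mfderiv_of_isSubmersionAt [I.Boundaryless] {f : M → N} {x : M}
    (hf : IsSubmersionAt I J ∞ f x) : Function.Surjective (mfderiv I J f x) := by
  obtain ⟨s, hs, hsx, hfs⟩ := exists_local_section hf
  exact surjective_mfderiv_of_local_section (hf.contMDiffAt.mdifferentiableAt (by simp))
    (hs.mdifferentiableAt (by simp)) hsx hfs

/-- A map on the target of a surjective submersion is smooth if its composition with the submersion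
is. -/
theorem contMDiff_of_comp_isSubmersion [I.Boundaryless]
    {E'' : Type*} [NormedAddCommGroup E''] [NormedSpace ℝ E'']
    {H'' : Type*} [TopologicalSpace H''] {K : ModelWithCorners ℝ E'' H''}
    {X : Type*} [TopologicalSpace X] [ChartedSpace H'' X]
    {f : M → N} (hf : IsSubmersion I J ∞ f) (hsurj : Function.Surjective f) {g : N → X}
    (hg : ContMDiff I K ∞ (g ∘ f)) : ContMDiff J K ∞ g := by
  intro y
  obtain ⟨x, rfl⟩ := hsurj y
  obtain ⟨s, hs, hsx, hfs⟩ := exists_local_section (hf.isSubmersionAt x)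
  refine ContMDiffAt.congr_of_eventuallyEq (hg.contMDiffAt.comp (f x) hs) ?_
  filter_upwards [hfs] with y hy
  simp [hy]

/-- A submersion is an open map. -/
theorem isOpenMap_of_isSubmersion [I.Boundaryless] {f : M → N} (hf : IsSubmersion I J ∞ f) :
    IsOpenMap f := by
  rw [isOpenMap_iff_nhds_le]
  intro x
  obtain ⟨s, hs, hsx, hfs⟩ := exists_local_section (hf.isSubmersionAt x)
  have h1 : Tendsto s (𝓝 (f x)) (𝓝 x) := by
    have := hs.continuousAt.tendsto; rwa [hsx] at this
  calc 𝓝 (f x) = Filter.map (f ∘ s) (𝓝 (f x)) := by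
        rw [Filter.map_congr (m₂ := id) (by simpa [EventuallyEq] using hfs), Filter.map_id]
    _ = Filter.map f (Filter.map s (𝓝 (f x))) := Filter.map_map.symm
    _ ≤ Filter.map f (𝓝 x) := Filter.map_mono h1

/-- The Hausdorff dimension of a smooth image of a second countable manifold is at most its
dimension. -/
theorem dimH_image_le_of_contMDiffOn [FiniteDimensional ℝ E] [I.Boundaryless]
    [SecondCountableTopology M] [IsManifold I ∞ M] {f : M → E'} {U : Set M} (hU : IsOpen U)
    (hf : ContMDiffOn I 𝓘(ℝ, E') ∞ f U) : dimH (f '' U) ≤ Module.finrank ℝ E := by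
  have h : ∀ x ∈ U, ∃ V ∈ 𝓝 x, dimH (f '' V) ≤ Module.finrank ℝ E := by
    intro x hx
    let φ := extChartAt I x
    have hO : IsOpen (φ.target ∩ φ.symm ⁻¹' U) := by
      refine (continuousOn_extChartAt_symm x).isOpen_inter_preimage ?_ hU
      exact isOpen_extChartAt_target x
    have hxO : φ x ∈ φ.target ∩ φ.symm ⁻¹' U :=
      ⟨mem_extChartAt_target x, by simpa [φ] using hx⟩
    -- The dimension bound for images is applied on a convex set, hence the ball.
    obtain ⟨r, hr, hball⟩ := Metric.isOpen_iff.1 hO _ hxO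
    have hg : ContDiffOn ℝ ∞ (f ∘ φ.symm) (Metric.ball (φ x) r) := by
      rw [← contMDiffOn_iff_contDiffOn]
      exact hf.comp ((contMDiffOn_extChartAt_symm x).mono fun v hv => (hball hv).1)
        fun v hv => (hball hv).2
    refine ⟨φ.source ∩ φ ⁻¹' Metric.ball (φ x) r, ?_, ?_⟩
    · exact inter_mem (extChartAt_source_mem_nhds x)
        ((continuousAt_extChartAt x).preimage_mem_nhds (Metric.ball_mem_nhds _ hr))
    · have hsub : f '' (φ.source ∩ φ ⁻¹' Metric.ball (φ x) r) ⊆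
          (f ∘ φ.symm) '' Metric.ball (φ x) r := by
        rintro _ ⟨y, hy, rfl⟩
        exact ⟨φ y, hy.2, by simp only [Function.comp_apply]; rw [φ.left_inv hy.1]⟩
      calc _ ≤ dimH ((f ∘ φ.symm) '' Metric.ball (φ x) r) := dimH_mono hsub
        _ ≤ dimH (Metric.ball (φ x) r) :=
          (hg.of_le (by simp)).dimH_image_le (convex_ball _ _) Subset.rfl
        _ ≤ dimH (univ : Set E) := dimH_mono (subset_univ _)
        _ = _ := Real.dimH_univ_eq_finrank E
  choose! V hV hdim using h
  -- Second countability leaves countably many pieces, and Hausdorff dimension is stable under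
  -- countable unions.
  obtain ⟨t, htU, htc, hcov⟩ := TopologicalSpace.countable_cover_nhdsWithin
    (s := U) (f := V) fun x hx => mem_nhdsWithin_of_mem_nhds (hV x hx)
  calc dimH (f '' U) ≤ dimH (⋃ x ∈ t, f '' V x) := by
        refine dimH_mono ?_
        rw [← image_iUnion₂]
        exact image_mono hcov
    _ = ⨆ x ∈ t, dimH (f '' V x) := dimH_bUnion htc _
    _ ≤ _ := iSup₂_le fun x hx => hdim x (htU hx)

end Submersions

/-! ### Vertical vectors of the projection to the orbit space -/

section Orbits

variable {EG : Type*} [NormedAddCommGroup EG] [NormedSpace ℝ EG]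
  {G : Type*} [TopologicalSpace G] [ChartedSpace EG G] [Group G]
  {EQ : Type*} [NormedAddCommGroup EQ] [NormedSpace ℝ EQ]
  {Q : Type*} [TopologicalSpace Q] [ChartedSpace EQ Q] [MulAction Gᵐᵒᵖ Q]
  {EB : Type*} [NormedAddCommGroup EB] [NormedSpace ℝ EB]
  [ChartedSpace EB (MulAction.orbitRel.Quotient Gᵐᵒᵖ Q)]

theorem contMDiff_orbitMap (hQ : IsSmoothFreeProper EG G EQ Q) (q : Q) :
    ContMDiff 𝓘(ℝ, EG) 𝓘(ℝ, EQ) ∞ (fun g : G => op g • q) :=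
  hQ.smooth.comp (contMDiff_const.prodMk contMDiff_id)

/-- The projection to the orbit space is constant along orbits. -/
theorem mfderiv_mk_infAction (hQ : IsSmoothFreeProper EG G EQ Q)
    (hQG : IsQuotientManifold EQ EB (MulAction.orbitRel Gᵐᵒᵖ Q)) (q : Q) (ξ : EG) :
    mfderiv 𝓘(ℝ, EQ) 𝓘(ℝ, EB) (Quotient.mk (MulAction.orbitRel Gᵐᵒᵖ Q)) q
      (infAction EG EQ G q ξ) = 0 := by
  -- The base point is written as `op 1 • q`, the value of the orbit map at `1`, so that the chain
  -- rule applies literally.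
  have h1 : HasMFDerivAt 𝓘(ℝ, EQ) 𝓘(ℝ, EB) (Quotient.mk (MulAction.orbitRel Gᵐᵒᵖ Q))
      (op (1 : G) • q) (mfderiv 𝓘(ℝ, EQ) 𝓘(ℝ, EB)
        (Quotient.mk (MulAction.orbitRel Gᵐᵒᵖ Q)) q : EQ →L[ℝ] EB) := by
    rw [op_one, one_smul]
    exact (hQG.isSubmersion.contMDiff.mdifferentiableAt (by simp)).hasMFDerivAt
  have h2 := h1.comp (1 : G)
    ((contMDiff_orbitMap hQ q).mdifferentiableAt (by simp)).hasMFDerivAt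
  have h3 : (Quotient.mk (MulAction.orbitRel Gᵐᵒᵖ Q) ∘ fun g : G => op g • q) =
      fun _ => Quotient.mk (MulAction.orbitRel Gᵐᵒᵖ Q) q := by
    funext g
    exact Quotient.sound ⟨op g, rfl⟩
  rw [h3] at h2
  have h4 := hasMFDerivAt_unique h2 (hasMFDerivAt_const _ _)
  exact DFunLike.congr_fun h4 ξ

variable [FiniteDimensional ℝ EG] [FiniteDimensional ℝ EQ] [FiniteDimensional ℝ EB]
  [SecondCountableTopology G] [IsManifold 𝓘(ℝ, EG) ∞ G]

/-- The fibres of the projection to the orbit space have at most the dimension of the group. -/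
theorem finrank_le_of_isQuotientManifold (hQ : IsSmoothFreeProper EG G EQ Q)
    (hQG : IsQuotientManifold EQ EB (MulAction.orbitRel Gᵐᵒᵖ Q)) (q : Q) :
    Module.finrank ℝ EQ ≤ Module.finrank ℝ EB + Module.finrank ℝ EG := by
  have hs := hQG.isSubmersion.isSubmersionAt q
  let d := hs.domChart
  let c := hs.codChart
  have hq : q ∈ d.source := hs.mem_domChart_source
  have : FiniteDimensional ℝ (EB × hs.complement) :=
    Module.Finite.equiv hs.equiv.toLinearEquiv
  have : FiniteDimensional ℝ hs.complement :=
    Module.Finite.of_surjective (LinearMap.snd ℝ EB hs.complement) LinearMap.snd_surjective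
  have hdim : Module.finrank ℝ EQ = Module.finrank ℝ EB + Module.finrank ℝ hs.complement := by
    rw [hs.equiv.toLinearEquiv.finrank_eq, Module.finrank_prod]
  have hwr : ∀ y ∈ d.source, c (Quotient.mk _ y) = (hs.equiv (d y)).1 := fun y hy => by
    have hyt : d y ∈ (d.extend 𝓘(ℝ, EQ)).target := (d.extend 𝓘(ℝ, EQ)).map_source (by simpa using hy)
    have := hs.writtenInCharts hyt
    simpa [d.left_inv hy, d, c] using this
  let b := (hs.equiv (d q)).1
  -- The slice of the chart through `q` on which the projection is constant.
  let ι : hs.complement → EQ := fun v => hs.equiv.symm (b, v)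
  have hι : Continuous ι := by fun_prop
  let O : Set G := {g | op g • q ∈ d.source}
  have hO : IsOpen O := d.open_source.preimage (contMDiff_orbitMap hQ q).continuous
  let f : G → hs.complement := fun g => (hs.equiv (d (op g • q))).2
  have hf : ContMDiffOn 𝓘(ℝ, EG) 𝓘(ℝ, hs.complement) ∞ f O := by
    have hd := contMDiffOn_of_mem_maximalAtlas hs.domChart_mem_maximalAtlas
    have := hd.comp (contMDiff_orbitMap hQ q).contMDiffOn (s := O) fun g hg => hg
    exact (contDiff_snd.comp hs.equiv.contDiff).contMDiff.comp_contMDiffOn this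
  -- Points of the slice have the same projection as `q`, so they lie in its orbit. An open piece of
  -- the complement is thus a smooth image of part of `G`.
  have hsub : ι ⁻¹' d.target ⊆ f '' O := by
    intro v hv
    have hv' := d.map_target hv
    have h1 := hwr _ hv'
    rw [d.right_inv hv] at h1
    have h2 : c (Quotient.mk _ (d.symm (ι v))) = c (Quotient.mk _ q) := by
      rw [h1, hwr q hq]; simp [ι, b]
    have h3 := c.injOn (hs.source_subset_preimage_source hv')
      (hs.source_subset_preimage_source hq) h2
    obtain ⟨g, hg⟩ := Quotient.exact h3
    have hg' : op g.unop • q = d.symm (ι v) := hg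
    refine ⟨g.unop, ?_, ?_⟩
    · change op g.unop • q ∈ d.source
      rwa [hg']
    · simp only [f]
      rw [hg', d.right_inv hv]
      simp [ι]
  have hmem : ι ⁻¹' d.target ∈ 𝓝 (hs.equiv (d q)).2 := by
    refine hι.continuousAt.preimage_mem_nhds (d.open_target.mem_nhds ?_)
    have : ι (hs.equiv (d q)).2 = d q := by simp [ι, b]
    rw [this]
    exact d.map_source hq
  have h1 : (Module.finrank ℝ hs.complement : ENNReal) ≤ Module.finrank ℝ EG := by
    rw [← Real.dimH_of_mem_nhds hmem]
    exact (dimH_mono hsub).trans (dimH_image_le_of_contMDiffOn hO hf)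
  have h2 : Module.finrank ℝ hs.complement ≤ Module.finrank ℝ EG := by exact_mod_cast h1
  omega

/-- Where the infinitesimal action is injective, the vertical vectors of the projection to the orbit
space are the infinitesimal generators, and the dimensions add up. -/
theorem exists_infAction_eq_of_mfderiv_mk_eq_zero (hQ : IsSmoothFreeProper EG G EQ Q)
    (hQG : IsQuotientManifold EQ EB (MulAction.orbitRel Gᵐᵒᵖ Q)) (q : Q)
    (hinj : Function.Injective (infAction EG EQ G q)) :
    Module.finrank ℝ EQ = Module.finrank ℝ EB + Module.finrank ℝ EG ∧
    ∀ w : TangentSpace 𝓘(ℝ, EQ) q,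
      mfderiv 𝓘(ℝ, EQ) 𝓘(ℝ, EB) (Quotient.mk (MulAction.orbitRel Gᵐᵒᵖ Q)) q w = 0 →
      ∃ ξ : EG, infAction EG EQ G q ξ = w := by
  let A : EQ →ₗ[ℝ] EB := (mfderiv 𝓘(ℝ, EQ) 𝓘(ℝ, EB)
    (Quotient.mk (MulAction.orbitRel Gᵐᵒᵖ Q)) q : EQ →L[ℝ] EB).toLinearMap
  let i : EG →ₗ[ℝ] EQ := (infAction EG EQ G q : EG →L[ℝ] EQ).toLinearMap
  have hA : Function.Surjective A :=
    surjective_mfderiv_of_isSubmersionAt (hQG.isSubmersion.isSubmersionAt q)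
  have hle := finrank_le_of_isQuotientManifold hQ hQG q
  have hrank := A.finrank_range_add_finrank_ker
  rw [LinearMap.range_eq_top.2 hA, finrank_top] at hrank
  have hi : Module.finrank ℝ i.range = Module.finrank ℝ EG := LinearMap.finrank_range_of_inj hinj
  have hsub : i.range ≤ A.ker := by
    rintro _ ⟨ξ, rfl⟩
    exact mfderiv_mk_infAction hQ hQG q ξ
  have hle' := Submodule.finrank_mono hsub
  -- The range has dimension `dim G` by injectivity, while the kernel has dimension `dim Q - dim
  -- Q/G`, which is at most `dim G`.
  have heq : i.range = A.ker := Submodule.eq_of_le_of_finrank_le hsub (by omega)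
  refine ⟨by omega, fun w hw => ?_⟩
  have : w ∈ i.range := by rw [heq]; exact hw
  exact this

end Orbits

/-! ### Smooth structure of the fibred product -/

section FibredTangentManifold

variable {EX : Type*} [NormedAddCommGroup EX] [NormedSpace ℝ EX]
  {X : Type*} [TopologicalSpace X] [ChartedSpace EX X]
  {EY : Type*} [NormedAddCommGroup EY] [NormedSpace ℝ EY]
  {Y : Type*} [TopologicalSpace Y] [ChartedSpace EY Y]
  {f : C(X, Y)}

/-- The canonical map `T_X Y → TY`, `(v, x) ↦ v`. -/
def FibredTangent.lift (z : FibredTangent EY f) : TangentBundle 𝓘(ℝ, EY) Y :=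
  ⟨f z.proj, z.vel⟩

/-- Comparing velocities inside `TY` avoids heterogeneous equalities between tangent spaces at
points that are only propositionally equal. -/
theorem FibredTangent.ext_lift {z z' : FibredTangent EY f} (h : z.proj = z'.proj)
    (h' : z.lift = z'.lift) : z = z' := by
  obtain ⟨x, v⟩ := z
  obtain ⟨x', v'⟩ := z'
  obtain rfl : x = x' := h
  have : v = v' := eq_of_heq (TotalSpace.mk.inj h').2
  rw [this]

variable [IsManifold 𝓘(ℝ, EY) ∞ Y]

theorem contMDiffVectorBundle_fibredTangent (hf : ContMDiff 𝓘(ℝ, EX) 𝓘(ℝ, EY) ∞ f) :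
    ContMDiffVectorBundle ∞ EY ((f : X → Y) *ᵖ (TangentSpace 𝓘(ℝ, EY) : Y → Type _))
      𝓘(ℝ, EX) :=
  ContMDiffVectorBundle.pullback EY (TangentSpace 𝓘(ℝ, EY) : Y → Type _) 𝓘(ℝ, EX)
    (⟨f, hf⟩ : ContMDiffMap 𝓘(ℝ, EX) 𝓘(ℝ, EY) X Y ∞)

theorem isManifold_fibredTangent [IsManifold 𝓘(ℝ, EX) ∞ X]
    (hf : ContMDiff 𝓘(ℝ, EX) 𝓘(ℝ, EY) ∞ f) :
    IsManifold (𝓘(ℝ, EX).prod 𝓘(ℝ, EY)) ∞ (FibredTangent EY f) :=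
  have := contMDiffVectorBundle_fibredTangent hf
  Bundle.TotalSpace.isManifold _ _

section

variable {EZ : Type*} [NormedAddCommGroup EZ] [NormedSpace ℝ EZ]
  {HZ : Type*} [TopologicalSpace HZ] {K : ModelWithCorners ℝ EZ HZ}
  {Z : Type*} [TopologicalSpace Z] [ChartedSpace HZ Z]

/-- A pullback bundle inherits its fibre coordinates from `TY`, so the two conditions differ only in
their base components. This is the universal property of the fibred product, through which
smoothness of maps into it is checked. -/
theorem contMDiffAt_fibredTangent_iff (hf : ContMDiff 𝓘(ℝ, EX) 𝓘(ℝ, EY) ∞ f)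
    {g : Z → FibredTangent EY f} {a : Z} :
    ContMDiffAt K (𝓘(ℝ, EX).prod 𝓘(ℝ, EY)) ∞ g a ↔
      ContMDiffAt K 𝓘(ℝ, EX) ∞ (fun x => (g x).proj) a ∧
      ContMDiffAt K 𝓘(ℝ, EY).tangent ∞ (fun x => (g x).lift) a := by
  rw [Bundle.contMDiffAt_totalSpace, Bundle.contMDiffAt_totalSpace]
  refine and_congr_right fun h => ?_
  refine ⟨fun h' => ⟨hf.contMDiffAt.comp a h, h'⟩, fun h' => h'.2⟩

theorem contMDiff_fibredTangent_iff (hf : ContMDiff 𝓘(ℝ, EX) 𝓘(ℝ, EY) ∞ f)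
    {g : Z → FibredTangent EY f} :
    ContMDiff K (𝓘(ℝ, EX).prod 𝓘(ℝ, EY)) ∞ g ↔
      ContMDiff K 𝓘(ℝ, EX) ∞ (fun x => (g x).proj) ∧
      ContMDiff K 𝓘(ℝ, EY).tangent ∞ (fun x => (g x).lift) :=
  ⟨fun h => ⟨fun a => ((contMDiffAt_fibredTangent_iff hf).1 (h a)).1,
    fun a => ((contMDiffAt_fibredTangent_iff hf).1 (h a)).2⟩,
    fun h a => (contMDiffAt_fibredTangent_iff hf).2 ⟨h.1 a, h.2 a⟩⟩

end

theorem contMDiff_proj_fibredTangent (hf : ContMDiff 𝓘(ℝ, EX) 𝓘(ℝ, EY) ∞ f) :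
    ContMDiff (𝓘(ℝ, EX).prod 𝓘(ℝ, EY)) 𝓘(ℝ, EX) ∞ (fun z : FibredTangent EY f => z.proj) :=
  ((contMDiff_fibredTangent_iff hf).1 contMDiff_id).1

theorem contMDiff_lift (hf : ContMDiff 𝓘(ℝ, EX) 𝓘(ℝ, EY) ∞ f) :
    ContMDiff (𝓘(ℝ, EX).prod 𝓘(ℝ, EY)) 𝓘(ℝ, EY).tangent ∞
      (FibredTangent.lift : FibredTangent EY f → TangentBundle 𝓘(ℝ, EY) Y) :=
  ((contMDiff_fibredTangent_iff hf).1 contMDiff_id).2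

variable (EY) in
/-- The canonical isomorphism of a nearby tangent space with the model space, in the preferred
trivialization at `y₀`. -/
noncomputable def tangentCoord (y₀ y : Y) : EY →L[ℝ] EY :=
  (trivializationAt EY (TangentSpace 𝓘(ℝ, EY)) y₀).continuousLinearMapAt ℝ y

variable (EY) in
/-- The inverse of `tangentCoord`. -/
noncomputable def tangentCoordSymm (y₀ y : Y) : EY →L[ℝ] EY :=
  (trivializationAt EY (TangentSpace 𝓘(ℝ, EY)) y₀).symmL ℝ y

theorem tangentCoordSymm_tangentCoord {y₀ y : Y}
    (hy : y ∈ (trivializationAt EY (TangentSpace 𝓘(ℝ, EY)) y₀).baseSet) (v : EY) :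
    tangentCoordSymm EY y₀ y (tangentCoord EY y₀ y v) = v :=
  (trivializationAt EY (TangentSpace 𝓘(ℝ, EY)) y₀).symmL_continuousLinearMapAt hy v

theorem trivializationAt_snd {y₀ y : Y}
    (hy : y ∈ (trivializationAt EY (TangentSpace 𝓘(ℝ, EY)) y₀).baseSet) (v : EY) :
    (trivializationAt EY (TangentSpace 𝓘(ℝ, EY)) y₀ (⟨y, v⟩ : TangentBundle 𝓘(ℝ, EY) Y)).2 =
      tangentCoord EY y₀ y v :=
  (Trivialization.continuousLinearMapAt_apply_of_mem ℝ _ hy v).symm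

theorem contMDiffAt_tangentCoord (hf : ContMDiff 𝓘(ℝ, EX) 𝓘(ℝ, EY) ∞ f)
    (z₀ : FibredTangent EY f) :
    ContMDiffAt (𝓘(ℝ, EX).prod 𝓘(ℝ, EY)) 𝓘(ℝ, EY) ∞
      (fun z : FibredTangent EY f => tangentCoord EY (f z₀.proj) (f z.proj) z.vel) z₀ := by
  have h := (Bundle.contMDiffAt_totalSpace.1 (contMDiff_lift hf z₀)).2
  refine h.congr_of_eventuallyEq ?_
  have h1 : ∀ᶠ z : FibredTangent EY f in 𝓝 z₀,
      f z.proj ∈ (trivializationAt EY (TangentSpace 𝓘(ℝ, EY)) (f z₀.proj)).baseSet := by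
    refine (hf.continuous.comp (contMDiff_proj_fibredTangent hf).continuous).continuousAt.eventually_mem
      ((Trivialization.open_baseSet _).mem_nhds (mem_baseSet_trivializationAt _ _ _))
  filter_upwards [h1] with z hz
  exact (trivializationAt_snd hz _).symm

/-- The fibrewise inverse of the preferred trivialization is smooth. -/
theorem contMDiffAt_mk_tangentCoordSymm (hf : ContMDiff 𝓘(ℝ, EX) 𝓘(ℝ, EY) ∞ f)
    (y₀ : Y) (x₀ : X) (hx : f x₀ ∈ (trivializationAt EY (TangentSpace 𝓘(ℝ, EY)) y₀).baseSet)
    (u : EY) :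
    ContMDiffAt (𝓘(ℝ, EX).prod 𝓘(ℝ, EY)) (𝓘(ℝ, EX).prod 𝓘(ℝ, EY)) ∞
      (fun a : X × EY => FibredTangent.mk EY f a.1 (tangentCoordSymm EY y₀ (f a.1) a.2)) (x₀, u) := by
  rw [contMDiffAt_fibredTangent_iff hf]
  refine ⟨contMDiffAt_fst, ?_⟩
  have h := (trivializationAt EY (TangentSpace 𝓘(ℝ, EY)) y₀).contMDiffOn_symm
    (IB := 𝓘(ℝ, EY)) (n := ∞)
  have hmem : (f x₀, u) ∈ (trivializationAt EY (TangentSpace 𝓘(ℝ, EY)) y₀).target :=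
    (trivializationAt EY (TangentSpace 𝓘(ℝ, EY)) y₀).mem_target.2 hx
  have h1 := h.contMDiffAt ((trivializationAt EY (TangentSpace 𝓘(ℝ, EY)) y₀).open_target.mem_nhds hmem)
  have h2 : ContMDiffAt (𝓘(ℝ, EX).prod 𝓘(ℝ, EY)) (𝓘(ℝ, EY).prod 𝓘(ℝ, EY)) ∞
      (fun a : X × EY => (f a.1, a.2)) (x₀, u) :=
    ((hf.comp contMDiff_fst).prodMk contMDiff_snd).contMDiffAt
  refine (ContMDiffAt.comp (x₀, u) h1 h2).congr_of_eventuallyEq ?_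
  have h3 : ∀ᶠ a : X × EY in 𝓝 (x₀, u),
      f a.1 ∈ (trivializationAt EY (TangentSpace 𝓘(ℝ, EY)) y₀).baseSet :=
    (hf.continuous.comp continuous_fst).continuousAt.eventually_mem
      ((Trivialization.open_baseSet _).mem_nhds hx)
  filter_upwards [h3] with a ha
  have h4 : tangentCoordSymm EY y₀ (f a.1) a.2 =
      (trivializationAt EY (TangentSpace 𝓘(ℝ, EY)) y₀).symm (f a.1) a.2 :=
    Trivialization.symmL_apply _ ha _
  have h5 := (trivializationAt EY (TangentSpace 𝓘(ℝ, EY)) y₀).mk_symm ha a.2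
  rw [← h4] at h5
  exact h5

/-- The inclusion of a fibre is smooth. -/
theorem contMDiff_fibredTangent_mk (hf : ContMDiff 𝓘(ℝ, EX) 𝓘(ℝ, EY) ∞ f) (x : X) :
    ContMDiff 𝓘(ℝ, EY) (𝓘(ℝ, EX).prod 𝓘(ℝ, EY)) ∞
      (fun v : EY => FibredTangent.mk EY f x v) := by
  intro v
  have hx : f x ∈ (trivializationAt EY (TangentSpace 𝓘(ℝ, EY)) (f x)).baseSet :=
    mem_baseSet_trivializationAt _ _ _
  have h := contMDiffAt_mk_tangentCoordSymm hf (f x) x hx (tangentCoord EY (f x) (f x) v)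
  have h2 : ContMDiffAt 𝓘(ℝ, EY) (𝓘(ℝ, EX).prod 𝓘(ℝ, EY)) ∞
      (fun v : EY => (x, tangentCoord EY (f x) (f x) v)) v :=
    contMDiffAt_const.prodMk (tangentCoord EY (f x) (f x)).contDiff.contMDiff.contMDiffAt
  refine (ContMDiffAt.comp v h h2).congr_of_eventuallyEq (Eventually.of_forall fun w => ?_)
  simp only [Function.comp_apply]
  rw [tangentCoordSymm_tangentCoord hx]

/-- The derivative of the inclusion of a fibre is injective. -/
theorem injective_mfderiv_fibredTangent_mk (hf : ContMDiff 𝓘(ℝ, EX) 𝓘(ℝ, EY) ∞ f) (x : X)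
    (v : EY) : Function.Injective (mfderiv 𝓘(ℝ, EY) (𝓘(ℝ, EX).prod 𝓘(ℝ, EY))
      (fun v : EY => FibredTangent.mk EY f x v) v) := by
  have hx : f x ∈ (trivializationAt EY (TangentSpace 𝓘(ℝ, EY)) (f x)).baseSet :=
    mem_baseSet_trivializationAt _ _ _
  have h1 := ((contMDiffAt_tangentCoord hf (FibredTangent.mk EY f x v)).mdifferentiableAt
    (by simp)).hasMFDerivAt
  have h2 := ((contMDiff_fibredTangent_mk hf x).mdifferentiableAt (x := v) (by simp)).hasMFDerivAt
  -- In the fibre coordinate the inclusion of the fibre is the linear map `tangentCoord`, which has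
  -- a left inverse.
  have h3 := h1.comp v h2
  have h4 : HasMFDerivAt 𝓘(ℝ, EY) 𝓘(ℝ, EY) (fun v : EY => tangentCoord EY (f x) (f x) v) v
      (tangentCoord EY (f x) (f x)) := (tangentCoord EY (f x) (f x)).hasMFDerivAt
  have h5 := hasMFDerivAt_unique h3 h4
  intro w w' hw
  have h6 : tangentCoord EY (f x) (f x) w = tangentCoord EY (f x) (f x) w' := by
    rw [← h5]
    exact congrArg (mfderiv (𝓘(ℝ, EX).prod 𝓘(ℝ, EY)) 𝓘(ℝ, EY) (fun z : FibredTangent EY f =>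
      tangentCoord EY (f x) (f z.proj) z.vel) (FibredTangent.mk EY f x v)) hw
  exact (tangentCoordSymm_tangentCoord hx w).symm.trans
    ((congrArg _ h6).trans (tangentCoordSymm_tangentCoord hx w'))

/-- A vector at `(v, x)` in the kernel of the derivative of the projection is tangent to the
fibre. -/
theorem exists_mfderiv_mk_eq_of_mfderiv_proj_eq_zero [FiniteDimensional ℝ EX]
    [FiniteDimensional ℝ EY] (hf : ContMDiff 𝓘(ℝ, EX) 𝓘(ℝ, EY) ∞ f) (x : X) (v : EY)
    (w : EX × EY)
    (hw : (mfderiv (𝓘(ℝ, EX).prod 𝓘(ℝ, EY)) 𝓘(ℝ, EX) (fun z : FibredTangent EY f => z.proj)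
      (FibredTangent.mk EY f x v) : EX × EY →L[ℝ] EX) w = 0) :
    ∃ u : EY, (mfderiv 𝓘(ℝ, EY) (𝓘(ℝ, EX).prod 𝓘(ℝ, EY))
      (fun v : EY => FibredTangent.mk EY f x v) v : EY →L[ℝ] EX × EY) u = w := by
  let A : EX × EY →ₗ[ℝ] EX := (mfderiv (𝓘(ℝ, EX).prod 𝓘(ℝ, EY)) 𝓘(ℝ, EX)
    (fun z : FibredTangent EY f => z.proj) (FibredTangent.mk EY f x v) :
      EX × EY →L[ℝ] EX).toLinearMap
  let i : EY →ₗ[ℝ] EX × EY := (mfderiv 𝓘(ℝ, EY) (𝓘(ℝ, EX).prod 𝓘(ℝ, EY))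
      (fun v : EY => FibredTangent.mk EY f x v) v : EY →L[ℝ] EX × EY).toLinearMap
  have hi : Function.Injective i := injective_mfderiv_fibredTangent_mk hf x v
  have hx : f x ∈ (trivializationAt EY (TangentSpace 𝓘(ℝ, EY)) (f x)).baseSet :=
    mem_baseSet_trivializationAt _ _ _
  have hproj : MDifferentiableAt (𝓘(ℝ, EX).prod 𝓘(ℝ, EY)) 𝓘(ℝ, EX)
      (fun z : FibredTangent EY f => z.proj) (FibredTangent.mk EY f x v) :=
    (contMDiff_proj_fibredTangent hf).mdifferentiableAt (by simp)
  have hA : Function.Surjective A := by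
    -- A local section through `(v, x)`, extending `v` with constant fibre coordinate. It makes `A`
    -- surjective, so its kernel has the dimension of the fibre.
    have hs : ContMDiffAt 𝓘(ℝ, EX) (𝓘(ℝ, EX).prod 𝓘(ℝ, EY)) ∞ (fun a : X =>
        FibredTangent.mk EY f a (tangentCoordSymm EY (f x) (f a) (tangentCoord EY (f x) (f x) v))) x :=
      ContMDiffAt.comp x (contMDiffAt_mk_tangentCoordSymm hf (f x) x hx _)
        (contMDiffAt_id.prodMk contMDiffAt_const)
    refine surjective_mfderiv_of_local_section hproj (hs.mdifferentiableAt (by simp)) ?_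
      (Eventually.of_forall fun y => rfl)
    exact congrArg (FibredTangent.mk EY f x) (tangentCoordSymm_tangentCoord hx v)
  have hsub : i.range ≤ A.ker := by
    rintro _ ⟨u, rfl⟩
    have h1 := hproj.hasMFDerivAt.comp v
      ((contMDiff_fibredTangent_mk hf x).mdifferentiableAt (x := v) (by simp)).hasMFDerivAt
    have h2 : HasMFDerivAt 𝓘(ℝ, EY) 𝓘(ℝ, EX) (fun _ : EY => x) v 0 := hasMFDerivAt_const x v
    exact DFunLike.congr_fun (hasMFDerivAt_unique h1 h2) u
  have hrank := A.finrank_range_add_finrank_ker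
  rw [LinearMap.range_eq_top.2 hA, finrank_top, Module.finrank_prod] at hrank
  have hr : Module.finrank ℝ i.range = Module.finrank ℝ EY := LinearMap.finrank_range_of_inj hi
  have heq : i.range = A.ker := Submodule.eq_of_le_of_finrank_le hsub (by omega)
  have : w ∈ i.range := by rw [heq]; exact hw
  exact this

end FibredTangentManifold

/-! ### Smoothness of a bundle projection -/

section FiberBundle

variable {EM : Type*} [NormedAddCommGroup EM] [NormedSpace ℝ EM]
  {M : Type*} [TopologicalSpace M] [ChartedSpace EM M]
  {EN : Type*} [NormedAddCommGroup EN] [NormedSpace ℝ EN]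
  {N : Type*} [TopologicalSpace N] [ChartedSpace EN N]
  {EF : Type*} [NormedAddCommGroup EF] [NormedSpace ℝ EF]
  {F : Type*} [TopologicalSpace F] [ChartedSpace EF F]

theorem IsSmoothFiberBundle.contMDiff {f : M → N} (hf : IsSmoothFiberBundle EM EN EF F f) :
    ContMDiff 𝓘(ℝ, EM) 𝓘(ℝ, EN) ∞ f := by
  intro x
  obtain ⟨e, he, he', -⟩ := hf.locally_trivial (f x)
  have hx : x ∈ e.source := e.mem_source.2 he
  refine (((contMDiff_fst.comp_contMDiffOn he').congr fun y hy => ?_).contMDiffAt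
    (e.open_source.mem_nhds hx))
  exact (e.coe_fst hy).symm

end FiberBundle

/-! ### Smoothness and equivariance of the momentum map -/

section Momentum

variable {EG : Type*} [NormedAddCommGroup EG] [NormedSpace ℝ EG]
  {G : Type*} [TopologicalSpace G] [ChartedSpace EG G] [Group G] [LieGroup 𝓘(ℝ, EG) ∞ G]
  {EQ : Type*} [NormedAddCommGroup EQ] [NormedSpace ℝ EQ]
  {Q : Type*} [TopologicalSpace Q] [ChartedSpace EQ Q] [MulAction Gᵐᵒᵖ Q]
  {EP : Type*} [NormedAddCommGroup EP] [NormedSpace ℝ EP]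
  {P : Type*} [TopologicalSpace P] [ChartedSpace EP P]

/-- The infinitesimal action intertwines the adjoint action and the tangent action. -/
theorem infAction_smul (hQ : IsSmoothFreeProper EG G EQ Q) (q : Q) (g : G) (ξ : EG) :
    (infAction EG EQ G (op g • q) ξ : EQ) =
      (mfderiv 𝓘(ℝ, EQ) 𝓘(ℝ, EQ) (fun q' : Q => op g • q') q : EQ →L[ℝ] EQ)
        (infAction EG EQ G q (Ad EG g ξ)) := by
  have hA : HasMFDerivAt 𝓘(ℝ, EG) 𝓘(ℝ, EG) (fun h : G => g * h * g⁻¹) 1 (Ad EG g) :=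
    (((contMDiff_const.mul contMDiff_id).mul contMDiff_const :
      ContMDiff 𝓘(ℝ, EG) 𝓘(ℝ, EG) ∞ (fun h : G => g * h * g⁻¹)).mdifferentiableAt
        (by simp)).hasMFDerivAt
  have hO : HasMFDerivAt 𝓘(ℝ, EG) 𝓘(ℝ, EQ) (fun h : G => op h • q) (g * 1 * g⁻¹)
      (infAction EG EQ G q : EG →L[ℝ] EQ) := by
    have : g * 1 * g⁻¹ = 1 := by simp
    rw [this]
    exact ((contMDiff_orbitMap hQ q).mdifferentiableAt (by simp)).hasMFDerivAt
  have hT : HasMFDerivAt 𝓘(ℝ, EQ) 𝓘(ℝ, EQ) (fun q' : Q => op g • q') (op (g * 1 * g⁻¹) • q)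
      (mfderiv 𝓘(ℝ, EQ) 𝓘(ℝ, EQ) (fun q' : Q => op g • q') q : EQ →L[ℝ] EQ) := by
    have : op (g * 1 * g⁻¹) • q = q := by simp
    rw [this]
    exact (mdifferentiable_act hQ g q).hasMFDerivAt
  have h1 := hT.comp (1 : G) (hO.comp (1 : G) hA)
  have h2 : HasMFDerivAt 𝓘(ℝ, EG) 𝓘(ℝ, EQ) (fun h : G => op h • op g • q) 1
      (infAction EG EQ G (op g • q) : EG →L[ℝ] EQ) :=
    ((contMDiff_orbitMap hQ (op g • q)).mdifferentiableAt (by simp)).hasMFDerivAt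
  -- This is the identity `(q · g h g⁻¹) g = (q g) h`, whose derivative at `h = 1` is the claim.
  have h3 : ((fun q' : Q => op g • q') ∘ ((fun h : G => op h • q) ∘ fun h : G => g * h * g⁻¹)) =
      fun h : G => op h • op g • q := by
    funext h
    simp [← mul_smul]
  rw [h3] at h1
  exact DFunLike.congr_fun (hasMFDerivAt_unique h2 h1) ξ

variable [IsManifold 𝓘(ℝ, EQ) ∞ Q]

/-- In local trivializations of the tangent bundle, the infinitesimal action is smooth. -/
theorem contMDiffAt_infAction (hQ : IsSmoothFreeProper EG G EQ Q) (q₀ : Q) :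
    ContMDiffAt 𝓘(ℝ, EQ) 𝓘(ℝ, EG →L[ℝ] EQ) ∞
      (fun q => (tangentCoord EQ q₀ q).comp (infAction EG EQ G q : EG →L[ℝ] EQ)) q₀ := by
  have : IsManifold 𝓘(ℝ, EG) 1 G := IsManifold.of_le (n := ∞) (by simp)
  have : IsManifold 𝓘(ℝ, EQ) 1 Q := IsManifold.of_le (n := ∞) (by simp)
  have h := ContMDiffAt.mfderiv (I := 𝓘(ℝ, EG)) (I' := 𝓘(ℝ, EQ)) (J := 𝓘(ℝ, EQ)) (n := ∞)
    (m := ∞) (x₀ := q₀) (fun (q : Q) (g : G) => op g • q) (fun _ => (1 : G))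
    hQ.smooth.contMDiffAt contMDiffAt_const (by simp)
  have hone : (1 : G) ∈ (trivializationAt EG (TangentSpace 𝓘(ℝ, EG)) (1 : G)).baseSet :=
    mem_baseSet_trivializationAt _ _ _
  -- The derivative comes expressed in trivializations on both sides. The one on `G` is taken at the
  -- fixed point `1`, and composing with the constant map `tangentCoord` there removes it.
  have h2 := h.clm_comp (contMDiffAt_const (c := tangentCoord EG (1 : G) 1))
  refine h2.congr_of_eventuallyEq (Eventually.of_forall fun q => ?_)
  ext ξ
  have h3 : tangentCoordSymm EG (1 : G) 1 (tangentCoord EG (1 : G) 1 ξ) = ξ :=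
    tangentCoordSymm_tangentCoord hone ξ
  have h4 : tangentCoord EQ q₀ q (infAction EG EQ G q ξ) =
      tangentCoord EQ (op (1 : G) • q₀) (op (1 : G) • q) (infAction EG EQ G q
        (tangentCoordSymm EG (1 : G) 1 (tangentCoord EG (1 : G) 1 ξ))) := by
    rw [h3, op_one, one_smul, one_smul]
  exact h4

variable {ε : C(P, Q)}

/-- The derivative along the fibres of a smooth function, in local trivializations. -/
theorem contMDiffAt_fderiv_fibre (hε : ContMDiff 𝓘(ℝ, EP) 𝓘(ℝ, EQ) ∞ ε)
    {L : FibredTangent EQ ε → ℝ} (hL : ContMDiff (𝓘(ℝ, EP).prod 𝓘(ℝ, EQ)) 𝓘(ℝ, ℝ) ∞ L)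
    [IsManifold 𝓘(ℝ, EP) ∞ P] (z₀ : FibredTangent EQ ε) :
    ContMDiffAt (𝓘(ℝ, EP).prod 𝓘(ℝ, EQ)) 𝓘(ℝ, EQ →L[ℝ] ℝ) ∞
      (fun z : FibredTangent EQ ε => fderiv ℝ (fun u : EQ => L (FibredTangent.mk EQ ε z.proj
        (tangentCoordSymm EQ (ε z₀.proj) (ε z.proj) u)))
        (tangentCoord EQ (ε z₀.proj) (ε z.proj) z.vel)) z₀ := by
  have := isManifold_fibredTangent (EX := EP) hε
  have hbase : ε z₀.proj ∈ (trivializationAt EQ (TangentSpace 𝓘(ℝ, EQ)) (ε z₀.proj)).baseSet :=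
    mem_baseSet_trivializationAt _ _ _
  -- In fibre coordinates `L` is a function on the fixed space `EQ` with `z` as a parameter, and the
  -- theorem on smooth dependence of derivatives applies.
  let f : FibredTangent EQ ε → EQ → ℝ := fun z u => L (FibredTangent.mk EQ ε z.proj
    (tangentCoordSymm EQ (ε z₀.proj) (ε z.proj) u))
  let g : FibredTangent EQ ε → EQ := fun z => tangentCoord EQ (ε z₀.proj) (ε z.proj) z.vel
  have hf : ContMDiffAt ((𝓘(ℝ, EP).prod 𝓘(ℝ, EQ)).prod 𝓘(ℝ, EQ)) 𝓘(ℝ, ℝ) ∞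
      (Function.uncurry f) (z₀, g z₀) := by
    refine hL.contMDiffAt.comp (z₀, g z₀) ?_
    have h1 : ContMDiffAt ((𝓘(ℝ, EP).prod 𝓘(ℝ, EQ)).prod 𝓘(ℝ, EQ)) (𝓘(ℝ, EP).prod 𝓘(ℝ, EQ)) ∞
        (fun a : FibredTangent EQ ε × EQ => (a.1.proj, a.2)) (z₀, g z₀) :=
      (((contMDiff_proj_fibredTangent hε).comp contMDiff_fst).prodMk contMDiff_snd).contMDiffAt
    exact ContMDiffAt.comp (z₀, g z₀)
      (contMDiffAt_mk_tangentCoordSymm hε (ε z₀.proj) z₀.proj hbase (g z₀)) h1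
  have h := ContMDiffAt.mfderiv (m := ∞) f g hf (contMDiffAt_tangentCoord hε z₀) (by simp)
  have e := inTangentCoordinates_model_space (I := 𝓘(ℝ, EQ)) (I' := 𝓘(ℝ, ℝ)) g
    (fun x => f x (g x))
    (fun x => (mfderiv 𝓘(ℝ, EQ) 𝓘(ℝ, ℝ) (f x) (g x) : EQ →L[ℝ] ℝ)) z₀
  have h' := (congrArg (fun F : FibredTangent EQ ε → EQ →L[ℝ] ℝ =>
    ContMDiffAt (𝓘(ℝ, EP).prod 𝓘(ℝ, EQ)) 𝓘(ℝ, EQ →L[ℝ] ℝ) ∞ F z₀) e).mp h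
  simp only [mfderiv_eq_fderiv] at h'
  exact h'

theorem differentiableAt_fibre (hε : ContMDiff 𝓘(ℝ, EP) 𝓘(ℝ, EQ) ∞ ε)
    {L : FibredTangent EQ ε → ℝ} (hL : ContMDiff (𝓘(ℝ, EP).prod 𝓘(ℝ, EQ)) 𝓘(ℝ, ℝ) ∞ L)
    (p : P) (v : EQ) : DifferentiableAt ℝ (fun w : EQ => L (FibredTangent.mk EQ ε p w)) v := by
  have := hL.comp (contMDiff_fibredTangent_mk hε p)
  exact (contMDiff_iff_contDiff.1 this).differentiable (by simp) v

/-- The momentum map is smooth. -/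
theorem contMDiff_momentum [IsManifold 𝓘(ℝ, EP) ∞ P] (hQ : IsSmoothFreeProper EG G EQ Q)
    (hε : ContMDiff 𝓘(ℝ, EP) 𝓘(ℝ, EQ) ∞ ε)
    {L : FibredTangent EQ ε → ℝ} (hL : ContMDiff (𝓘(ℝ, EP).prod 𝓘(ℝ, EQ)) 𝓘(ℝ, ℝ) ∞ L)
    {δ : P → EG →L[ℝ] ℝ} (hδ : ContMDiff 𝓘(ℝ, EP) 𝓘(ℝ, EG →L[ℝ] ℝ) ∞ δ) :
    ContMDiff (𝓘(ℝ, EP).prod 𝓘(ℝ, EQ)) 𝓘(ℝ, EG →L[ℝ] ℝ) ∞ (momentum G L δ) := by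
  intro z₀
  have hεproj := hε.comp (contMDiff_proj_fibredTangent hε)
  have h1 := (contMDiffAt_fderiv_fibre hε hL z₀).clm_comp
    (ContMDiffAt.comp z₀ (contMDiffAt_infAction hQ (ε z₀.proj)) (hεproj z₀))
  have h2 := h1.sub (hδ.comp (contMDiff_proj_fibredTangent hε) z₀)
  refine h2.congr_of_eventuallyEq ?_
  have h3 : ∀ᶠ z : FibredTangent EQ ε in 𝓝 z₀,
      ε z.proj ∈ (trivializationAt EQ (TangentSpace 𝓘(ℝ, EQ)) (ε z₀.proj)).baseSet :=
    hεproj.continuous.continuousAt.eventually_mem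
      ((Trivialization.open_baseSet _).mem_nhds (mem_baseSet_trivializationAt _ _ _))
  filter_upwards [h3] with z hz
  obtain ⟨p, v⟩ := z
  change EQ at v
  have hz : ε p ∈ (trivializationAt EQ (TangentSpace 𝓘(ℝ, EQ)) (ε z₀.proj)).baseSet := hz
  -- Since `S ∘ T = id`, the chain rule gives `𝔽L(v, p) = D(L ∘ S)(T v) ∘ T`. Moving `T` onto the
  -- infinitesimal action yields the two factors already known to be smooth.
  let S : EQ →L[ℝ] EQ := tangentCoordSymm EQ (ε z₀.proj) (ε p)
  let T : EQ →L[ℝ] EQ := tangentCoord EQ (ε z₀.proj) (ε p)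
  have hST : ∀ w, S (T w) = w := tangentCoordSymm_tangentCoord hz
  have hd : HasFDerivAt (fun u : EQ => L (FibredTangent.mk EQ ε p (S u)))
      (fderiv ℝ (fun u : EQ => L (FibredTangent.mk EQ ε p (S u))) (T v)) (T v) :=
    ((differentiableAt_fibre hε hL p (S (T v))).comp (T v) S.differentiableAt).hasFDerivAt
  have hc : HasFDerivAt (fun w : EQ => L (FibredTangent.mk EQ ε p w))
      ((fderiv ℝ (fun u : EQ => L (FibredTangent.mk EQ ε p (S u))) (T v)).comp T) v := by
    have := hd.comp v T.hasFDerivAt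
    refine this.congr_of_eventuallyEq (Eventually.of_forall fun w => ?_)
    simp only [Function.comp_apply]
    exact congrArg (fun w => L (FibredTangent.mk EQ ε p w)) (hST w).symm
  change (fderiv ℝ (fun w : EQ => L (FibredTangent.mk EQ ε p w)) v : EQ →L[ℝ] ℝ).comp
    (infAction EG EQ G (ε p) : EG →L[ℝ] EQ) - δ p =
    (fderiv ℝ (fun u : EQ => L (FibredTangent.mk EQ ε p (S u))) (T v)).comp
      (T.comp (infAction EG EQ G (ε p) : EG →L[ℝ] EQ)) - δ p
  rw [hc.fderiv]
  rfl

variable [MulAction Gᵐᵒᵖ P]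

/-- The momentum map is equivariant up to the potential. -/
theorem momentum_liftedAct (hQ : IsSmoothFreeProper EG G EQ Q)
    (hεs : ContMDiff 𝓘(ℝ, EP) 𝓘(ℝ, EQ) ∞ ε) (hε : Equivariant G ε)
    {L : FibredTangent EQ ε → ℝ} (hL : ContMDiff (𝓘(ℝ, EP).prod 𝓘(ℝ, EQ)) 𝓘(ℝ, ℝ) ∞ L)
    (hLinv : ∀ (g : G) (z : FibredTangent EQ ε), L (liftedAct hε g z) = L z)
    (δ : P → EG →L[ℝ] ℝ) (g : G) (z : FibredTangent EQ ε) :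
    momentum G L δ (liftedAct hε g z) + δ (op g • z.proj) =
      coAd g (momentum G L δ z + δ z.proj) := by
  obtain ⟨p, v⟩ := z
  change EQ at v
  let A : EQ →L[ℝ] EQ := mfderiv 𝓘(ℝ, EQ) 𝓘(ℝ, EQ) (fun q' : Q => op g • q') (ε p)
  have hd := (differentiableAt_fibre hεs hL (op g • p) (A v)).hasFDerivAt.comp v A.hasFDerivAt
  -- Differentiating invariance along the fibre gives `𝔽L(z g) ∘ TΨ_g = 𝔽L(z)`.
  have hinv : (fun w : EQ => L (FibredTangent.mk EQ ε (op g • p) w)) ∘ A =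
      fun w : EQ => L (FibredTangent.mk EQ ε p w) := by
    funext w
    exact hLinv g (FibredTangent.mk EQ ε p w)
  rw [hinv] at hd
  ext ξ
  have h1 : (infAction EG EQ G (ε (op g • p)) ξ : EQ) =
      A (infAction EG EQ G (ε p) (Ad EG g ξ)) := by
    have h := infAction_smul hQ (ε p) g ξ
    rw [← hε g p] at h
    exact h
  have h2 : (fderiv ℝ (fun w : EQ => L (FibredTangent.mk EQ ε (op g • p) w)) (A v) : EQ →L[ℝ] ℝ)
      (infAction EG EQ G (ε (op g • p)) ξ) =
      (fderiv ℝ (fun w : EQ => L (FibredTangent.mk EQ ε p w)) v : EQ →L[ℝ] ℝ)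
        (infAction EG EQ G (ε p) (Ad EG g ξ)) := by
    rw [hd.fderiv]
    exact congrArg _ h1
  change (fderiv ℝ (fun w : EQ => L (FibredTangent.mk EQ ε (op g • p) w)) (A v) : EQ →L[ℝ] ℝ)
      (infAction EG EQ G (ε (op g • p)) ξ) - δ (op g • p) ξ + δ (op g • p) ξ =
    (fderiv ℝ (fun w : EQ => L (FibredTangent.mk EQ ε p w)) v : EQ →L[ℝ] ℝ)
        (infAction EG EQ G (ε p) (Ad EG g ξ)) - δ p (Ad EG g ξ) + δ p (Ad EG g ξ)
  rw [sub_add_cancel, sub_add_cancel, h2]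

/-- The level set of the momentum map is invariant under the isotropy group. -/
theorem liftedAct_mem_levelSet (hQ : IsSmoothFreeProper EG G EQ Q)
    (hεs : ContMDiff 𝓘(ℝ, EP) 𝓘(ℝ, EQ) ∞ ε) (hε : Equivariant G ε)
    {L : FibredTangent EQ ε → ℝ} (hL : ContMDiff (𝓘(ℝ, EP).prod 𝓘(ℝ, EQ)) 𝓘(ℝ, ℝ) ∞ L)
    (hLinv : ∀ (g : G) (z : FibredTangent EQ ε), L (liftedAct hε g z) = L z)
    {δ : P → EG →L[ℝ] ℝ} {μ : EG →L[ℝ] ℝ} {g : G} (hg : g ∈ isotropy G δ μ)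
    {z : FibredTangent EQ ε} (hz : z ∈ levelSet G L δ μ) :
    liftedAct hε g z ∈ levelSet G L δ μ := by
  have h1 := momentum_liftedAct hQ hεs hε hL hLinv δ g z
  have hz' : momentum G L δ z = μ := hz
  rw [hz', (fixed_iff δ μ z.proj g).1 (hg z.proj)] at h1
  exact add_right_cancel h1

end Momentum

/-! ### The projection from `T_P Q` to `T_P (Q/G)` -/

section OrbitMk

variable {G : Type*} [Group G]
  {EQ : Type*} [NormedAddCommGroup EQ] [NormedSpace ℝ EQ]
  {Q : Type*} [TopologicalSpace Q] [ChartedSpace EQ Q] [MulAction Gᵐᵒᵖ Q]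
  {EP : Type*} [NormedAddCommGroup EP] [NormedSpace ℝ EP]
  {P : Type*} [TopologicalSpace P] [ChartedSpace EP P]
  {EB : Type*} [NormedAddCommGroup EB] [NormedSpace ℝ EB]
  [ChartedSpace EB (MulAction.orbitRel.Quotient Gᵐᵒᵖ Q)]
  {ε : C(P, Q)}

variable (G) in
/-- The map `P → Q/G`, `p ↦ [ε p]`. -/
def orbitMk (ε : C(P, Q)) : C(P, MulAction.orbitRel.Quotient Gᵐᵒᵖ Q) :=
  ⟨fun p => Quotient.mk (MulAction.orbitRel Gᵐᵒᵖ Q) (ε p),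
    continuous_quotient_mk'.comp ε.continuous⟩

variable (G EB) in
/-- The map `T_P Q → T_P (Q/G)`, `(v, p) ↦ (Tπ v, p)`. -/
noncomputable def tangentProj (z : FibredTangent EQ ε) : FibredTangent EB (orbitMk G ε) :=
  FibredTangent.mk EB (orbitMk G ε) z.proj
    (mfderiv 𝓘(ℝ, EQ) 𝓘(ℝ, EB) (Quotient.mk (MulAction.orbitRel Gᵐᵒᵖ Q)) (ε z.proj) z.vel)

theorem surjective_mfderiv_mk (hQG : IsQuotientManifold EQ EB (MulAction.orbitRel Gᵐᵒᵖ Q)) (q : Q) :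
    Function.Surjective
      (mfderiv 𝓘(ℝ, EQ) 𝓘(ℝ, EB) (Quotient.mk (MulAction.orbitRel Gᵐᵒᵖ Q)) q) :=
  surjective_mfderiv_of_isSubmersionAt (hQG.isSubmersion.isSubmersionAt q)

theorem contMDiff_orbitMk
    (hQG : IsQuotientManifold EQ EB (MulAction.orbitRel Gᵐᵒᵖ Q))
    (hεs : ContMDiff 𝓘(ℝ, EP) 𝓘(ℝ, EQ) ∞ ε) :
    ContMDiff 𝓘(ℝ, EP) 𝓘(ℝ, EB) ∞ (orbitMk G ε) :=
  hQG.isSubmersion.contMDiff.comp hεs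

variable [IsManifold 𝓘(ℝ, EQ) ∞ Q] [IsManifold 𝓘(ℝ, EB) ∞ (MulAction.orbitRel.Quotient Gᵐᵒᵖ Q)]

theorem contMDiff_tangentProj
    (hQG : IsQuotientManifold EQ EB (MulAction.orbitRel Gᵐᵒᵖ Q))
    (hεs : ContMDiff 𝓘(ℝ, EP) 𝓘(ℝ, EQ) ∞ ε) :
    ContMDiff (𝓘(ℝ, EP).prod 𝓘(ℝ, EQ)) (𝓘(ℝ, EP).prod 𝓘(ℝ, EB)) ∞
      (tangentProj G EB : FibredTangent EQ ε → FibredTangent EB (orbitMk G ε)) := by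
  have : IsManifold 𝓘(ℝ, EQ) 1 Q := IsManifold.of_le (n := ∞) (by simp)
  have : IsManifold 𝓘(ℝ, EB) 1 (MulAction.orbitRel.Quotient Gᵐᵒᵖ Q) :=
    IsManifold.of_le (n := ∞) (by simp)
  rw [contMDiff_fibredTangent_iff (contMDiff_orbitMk hQG hεs)]
  exact ⟨contMDiff_proj_fibredTangent hεs,
    (hQG.isSubmersion.contMDiff.contMDiff_tangentMap (m := ∞) (by simp)).comp (contMDiff_lift hεs)⟩

end OrbitMk

/-! ### Reduced velocity and momentum as global coordinates on `T_P Q` -/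

section TangentProj

variable {EG : Type*} [NormedAddCommGroup EG] [NormedSpace ℝ EG]
  {G : Type*} [TopologicalSpace G] [ChartedSpace EG G] [Group G]
  {EQ : Type*} [NormedAddCommGroup EQ] [NormedSpace ℝ EQ]
  {Q : Type*} [TopologicalSpace Q] [ChartedSpace EQ Q] [MulAction Gᵐᵒᵖ Q]
  {EP : Type*} [NormedAddCommGroup EP] [NormedSpace ℝ EP]
  {P : Type*} [TopologicalSpace P] [ChartedSpace EP P]
  {EB : Type*} [NormedAddCommGroup EB] [NormedSpace ℝ EB]
  [ChartedSpace EB (MulAction.orbitRel.Quotient Gᵐᵒᵖ Q)]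
  {ε : C(P, Q)}

/-- The injective map `ξ ↦ J(v + ξ_Q, p)` depends on `ξ` only through `ξ_Q(ε p)`. -/
theorem injective_infAction {L : FibredTangent EQ ε → ℝ} {δ : P → EG →L[ℝ] ℝ}
    (hreg : IsGRegular G L δ) (p : P) : Function.Injective (infAction EG EQ G (ε p)) := by
  obtain ⟨Φ, hΦ⟩ := hreg p 0
  intro ξ ξ' h
  refine Φ.injective (?_ : Φ ξ = Φ ξ')
  rw [hΦ, hΦ, h]

theorem existsUnique_mem_levelSet {L : FibredTangent EQ ε → ℝ} {δ : P → EG →L[ℝ] ℝ}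
    (hreg : IsGRegular G L δ) (μ : EG →L[ℝ] ℝ) (p : P) (v : TangentSpace 𝓘(ℝ, EQ) (ε p)) :
    ∃! ξ : EG, FibredTangent.mk EQ ε p (v + infAction EG EQ G (ε p) ξ) ∈ levelSet G L δ μ := by
  obtain ⟨Φ, hΦ⟩ := hreg p v
  refine ⟨Φ.symm μ, ?_, fun ξ hξ => ?_⟩
  · have := hΦ (Φ.symm μ)
    rw [Φ.apply_symm_apply] at this
    exact this.symm
  · have h : Φ ξ = μ := (hΦ ξ).trans hξ
    rw [← h, Φ.symm_apply_apply]

variable [FiniteDimensional ℝ EG] [FiniteDimensional ℝ EQ] [FiniteDimensional ℝ EB]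
  [SecondCountableTopology G] [LieGroup 𝓘(ℝ, EG) ∞ G]

/-- Two vectors over the same point with the same projection to `T(Q/G)` differ by an infinitesimal
generator. -/
theorem exists_eq_add_infAction (hQ : IsSmoothFreeProper EG G EQ Q)
    (hQG : IsQuotientManifold EQ EB (MulAction.orbitRel Gᵐᵒᵖ Q))
    {L : FibredTangent EQ ε → ℝ} {δ : P → EG →L[ℝ] ℝ} (hreg : IsGRegular G L δ)
    (p : P) {v v' : TangentSpace 𝓘(ℝ, EQ) (ε p)}
    (h : mfderiv 𝓘(ℝ, EQ) 𝓘(ℝ, EB) (Quotient.mk (MulAction.orbitRel Gᵐᵒᵖ Q)) (ε p) v =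
      mfderiv 𝓘(ℝ, EQ) 𝓘(ℝ, EB) (Quotient.mk (MulAction.orbitRel Gᵐᵒᵖ Q)) (ε p) v') :
    ∃ ξ : EG, v' = v + infAction EG EQ G (ε p) ξ := by
  obtain ⟨ξ, hξ⟩ := (exists_infAction_eq_of_mfderiv_mk_eq_zero hQ hQG (ε p)
    (injective_infAction hreg p)).2 (v' - v) (by rw [map_sub, h, sub_self])
  exact ⟨ξ, by rw [hξ]; abel⟩

/-- The reduced velocity together with the momentum determines a point of `T_P Q`. -/
theorem bijective_tangentProj_momentum (hQ : IsSmoothFreeProper EG G EQ Q)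
    (hQG : IsQuotientManifold EQ EB (MulAction.orbitRel Gᵐᵒᵖ Q))
    {L : FibredTangent EQ ε → ℝ} {δ : P → EG →L[ℝ] ℝ} (hreg : IsGRegular G L δ) :
    Function.Bijective (fun z : FibredTangent EQ ε => (tangentProj G EB z, momentum G L δ z)) := by
  constructor
  · rintro ⟨p, v : TangentSpace 𝓘(ℝ, EQ) (ε p)⟩ ⟨p', v' : TangentSpace 𝓘(ℝ, EQ) (ε p')⟩ h
    obtain ⟨h1, h2⟩ := Prod.mk.inj h
    obtain rfl : p = p' := congrArg TotalSpace.proj h1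
    obtain ⟨ξ, hξ⟩ := exists_eq_add_infAction hQ hQG hreg p
      (eq_of_heq (TotalSpace.mk.inj h1).2)
    -- Both `ξ` and `0` solve `J(v + ξ_Q, p) = J(v, p)`, so uniqueness gives `ξ = 0`.
    obtain ⟨ξ', -, hu⟩ := existsUnique_mem_levelSet hreg (momentum G L δ ⟨p, v⟩) p v
    have hv : v' = v + infAction EG EQ G (ε p) ξ := hξ
    have h3 : ξ = ξ' := hu ξ (by
      change FibredTangent.mk EQ ε p (v + infAction EG EQ G (ε p) ξ) ∈ _
      rw [← hv]
      exact h2.symm)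
    have h4 : 0 = ξ' := hu 0 (by
      change FibredTangent.mk EQ ε p (v + infAction EG EQ G (ε p) 0) ∈ _
      rw [map_zero, add_zero]
      rfl)
    rw [h3, ← h4, map_zero, add_zero] at hv
    rw [hv]
  · rintro ⟨⟨p, w⟩, ν⟩
    obtain ⟨v, hv⟩ := surjective_mfderiv_mk hQG (ε p) w
    obtain ⟨ξ, hξ, -⟩ := existsUnique_mem_levelSet hreg ν p v
    refine ⟨FibredTangent.mk EQ ε p (v + infAction EG EQ G (ε p) ξ), Prod.ext ?_ hξ⟩
    refine congrArg (FibredTangent.mk EB (orbitMk G ε) p) (Eq.trans ?_ hv)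
    change mfderiv 𝓘(ℝ, EQ) 𝓘(ℝ, EB) (Quotient.mk (MulAction.orbitRel Gᵐᵒᵖ Q)) (ε p)
      (v + infAction EG EQ G (ε p) ξ) = _
    rw [map_add, mfderiv_mk_infAction hQ hQG, add_zero]

variable [IsManifold 𝓘(ℝ, EQ) ∞ Q] [IsManifold 𝓘(ℝ, EB) ∞ (MulAction.orbitRel.Quotient Gᵐᵒᵖ Q)]
variable [IsManifold 𝓘(ℝ, EP) ∞ P] [FiniteDimensional ℝ EP]

/-- A kernel vector is reduced in three stages: it is tangent to the fibre over `p`, then it is an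
infinitesimal generator `ξ_Q`, and finally `ξ` is killed by the derivative of the diffeomorphism `ξ
↦ J(v + ξ_Q, p)`. A smooth bijection alone would not suffice at the last stage. -/
theorem injective_mfderiv_tangentProj_momentum (hQ : IsSmoothFreeProper EG G EQ Q)
    (hQG : IsQuotientManifold EQ EB (MulAction.orbitRel Gᵐᵒᵖ Q))
    (hεs : ContMDiff 𝓘(ℝ, EP) 𝓘(ℝ, EQ) ∞ ε)
    {L : FibredTangent EQ ε → ℝ} (hL : ContMDiff (𝓘(ℝ, EP).prod 𝓘(ℝ, EQ)) 𝓘(ℝ, ℝ) ∞ L)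
    {δ : P → EG →L[ℝ] ℝ} (hδ : ContMDiff 𝓘(ℝ, EP) 𝓘(ℝ, EG →L[ℝ] ℝ) ∞ δ)
    (hreg : IsGRegular G L δ) (z : FibredTangent EQ ε) :
    Function.Injective (mfderiv (𝓘(ℝ, EP).prod 𝓘(ℝ, EQ))
      ((𝓘(ℝ, EP).prod 𝓘(ℝ, EB)).prod 𝓘(ℝ, EG →L[ℝ] ℝ))
      (fun z : FibredTangent EQ ε => (tangentProj G EB z, momentum G L δ z)) z) := by
  obtain ⟨p, v⟩ := z
  change EQ at v
  have hb := contMDiff_orbitMk hQG hεs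
  have hΘ := ((contMDiff_tangentProj hQG hεs).mdifferentiableAt (x := ⟨p, v⟩) (by simp)).hasMFDerivAt
  have hJ := ((contMDiff_momentum hQ hεs hL hδ).mdifferentiableAt (x := ⟨p, v⟩)
    (by simp)).hasMFDerivAt
  rw [(hΘ.prodMk hJ).mfderiv]
  let A : EP × EQ →L[ℝ] EP × EB := mfderiv (𝓘(ℝ, EP).prod 𝓘(ℝ, EQ)) (𝓘(ℝ, EP).prod 𝓘(ℝ, EB))
    (tangentProj G EB : FibredTangent EQ ε → FibredTangent EB (orbitMk G ε)) ⟨p, v⟩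
  let N : EP × EQ →L[ℝ] EG →L[ℝ] ℝ :=
    mfderiv (𝓘(ℝ, EP).prod 𝓘(ℝ, EQ)) 𝓘(ℝ, EG →L[ℝ] ℝ) (momentum G L δ) ⟨p, v⟩
  suffices key : ∀ w : EP × EQ, A w = 0 → N w = 0 → w = 0 by
    intro w w' hw
    have hA : A w = A w' := congrArg Prod.fst hw
    have hN : N w = N w' := congrArg Prod.snd hw
    exact sub_eq_zero.1 (key (w - w') ((A.map_sub w w').trans (sub_eq_zero.2 hA))
      ((N.map_sub w w').trans (sub_eq_zero.2 hN)))
  intro w hw1 hw2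
  have hproj := ((contMDiff_proj_fibredTangent hb).mdifferentiableAt
    (x := tangentProj G EB (⟨p, v⟩ : FibredTangent EQ ε)) (by simp)).hasMFDerivAt
  have h1 := (hproj.comp _ hΘ).mfderiv
  -- `tangentProj` covers the identity of `P`, so the projection to `P` factors through it.
  have h2 : mfderiv (𝓘(ℝ, EP).prod 𝓘(ℝ, EQ)) 𝓘(ℝ, EP) (fun z : FibredTangent EQ ε => z.proj)
      (⟨p, v⟩ : FibredTangent EQ ε) w = 0 := by
    refine (DFunLike.congr_fun h1 w).trans ?_
    let C : EP × EB →L[ℝ] EP := mfderiv (𝓘(ℝ, EP).prod 𝓘(ℝ, EB)) 𝓘(ℝ, EP)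
      (fun z : FibredTangent EB (orbitMk G ε) => z.proj)
      (tangentProj G EB (⟨p, v⟩ : FibredTangent EQ ε))
    exact (congrArg C hw1).trans C.map_zero
  obtain ⟨u, hu⟩ := exists_mfderiv_mk_eq_of_mfderiv_proj_eq_zero hεs p v w h2
  let B : EQ →L[ℝ] EB := mfderiv 𝓘(ℝ, EQ) 𝓘(ℝ, EB)
    (Quotient.mk (MulAction.orbitRel Gᵐᵒᵖ Q)) (ε p)
  have hmk := ((contMDiff_fibredTangent_mk hεs p).mdifferentiableAt (x := v) (by simp)).hasMFDerivAt
  have hmk' := ((contMDiff_fibredTangent_mk hb p).mdifferentiableAt (x := B v)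
    (by simp)).hasMFDerivAt
  have h3 := HasMFDerivAt.comp v hΘ hmk
  have h4 := HasMFDerivAt.comp v hmk' B.hasMFDerivAt
  -- On the fibre over `p`, `tangentProj` is the linear map `B = Tπ`.
  have h5 := DFunLike.congr_fun (hasMFDerivAt_unique h4 h3) u
  have h6 : B u = 0 := by
    apply injective_mfderiv_fibredTangent_mk hb p (B v)
    refine Eq.trans h5 (Eq.trans ((congrArg A hu).trans hw1) (map_zero _).symm)
  obtain ⟨ξ, hξ⟩ := (exists_infAction_eq_of_mfderiv_mk_eq_zero hQ hQG (ε p)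
    (injective_infAction hreg p)).2 u h6
  obtain ⟨Φ, hΦ⟩ := hreg p v
  let i : EG →L[ℝ] EQ := infAction EG EQ G (ε p)
  have h7 : HasMFDerivAt 𝓘(ℝ, EG) 𝓘(ℝ, EQ) (fun ξ : EG => v + i ξ) 0 i :=
    (i.hasFDerivAt.const_add v).hasMFDerivAt
  have h0 : v + i 0 = v := by simp
  have h8 := HasMFDerivAt.comp (0 : EG) (g := momentum G L δ ∘ fun v : EQ => FibredTangent.mk EQ ε p v)
    (by rw [h0]; exact HasMFDerivAt.comp v hJ hmk) h7
  have h9 : HasMFDerivAt 𝓘(ℝ, EG) 𝓘(ℝ, EG →L[ℝ] ℝ) Φ 0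
      (mfderiv 𝓘(ℝ, EG) 𝓘(ℝ, EG →L[ℝ] ℝ) Φ 0) :=
    (Φ.contMDiff.mdifferentiableAt (by simp)).hasMFDerivAt
  have h10 : (momentum G L δ ∘ fun v : EQ => FibredTangent.mk EQ ε p v) ∘ (fun ξ : EG => v + i ξ) =
      Φ := by
    funext ξ
    exact (hΦ ξ).symm
  rw [h10] at h8
  have h11 := DFunLike.congr_fun (hasMFDerivAt_unique h9 h8) ξ
  have h12 : mfderiv 𝓘(ℝ, EG) 𝓘(ℝ, EG →L[ℝ] ℝ) Φ 0 ξ = 0 := by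
    refine h11.trans ?_
    refine Eq.trans ?_ hw2
    rw [← hu]
    exact congrArg (fun u : EQ => N ((mfderiv 𝓘(ℝ, EQ) (𝓘(ℝ, EP).prod 𝓘(ℝ, EQ))
      (fun v : EQ => FibredTangent.mk EQ ε p v) v : EQ →L[ℝ] EP × EQ) u)) hξ
  have h13 : ξ = 0 := by
    apply (Φ.mfderivToContinuousLinearEquiv (by simp) 0).injective
    exact h12.trans (map_zero _).symm
  rw [← hu, ← hξ, h13, map_zero]
  exact map_zero _

/-- The map `(v, p) ↦ ((Tπ v, p), J(v, p))` is a diffeomorphism. -/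
theorem exists_equiv_tangentProj_momentum (hQ : IsSmoothFreeProper EG G EQ Q)
    (hQG : IsQuotientManifold EQ EB (MulAction.orbitRel Gᵐᵒᵖ Q))
    (hεs : ContMDiff 𝓘(ℝ, EP) 𝓘(ℝ, EQ) ∞ ε)
    {L : FibredTangent EQ ε → ℝ} (hL : ContMDiff (𝓘(ℝ, EP).prod 𝓘(ℝ, EQ)) 𝓘(ℝ, ℝ) ∞ L)
    {δ : P → EG →L[ℝ] ℝ} (hδ : ContMDiff 𝓘(ℝ, EP) 𝓘(ℝ, EG →L[ℝ] ℝ) ∞ δ)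
    (hreg : IsGRegular G L δ) :
    ∃ D : FibredTangent EQ ε ≃ FibredTangent EB (orbitMk G ε) × (EG →L[ℝ] ℝ),
      (∀ z, D z = (tangentProj G EB z, momentum G L δ z)) ∧
      ContMDiff ((𝓘(ℝ, EP).prod 𝓘(ℝ, EB)).prod 𝓘(ℝ, EG →L[ℝ] ℝ)) (𝓘(ℝ, EP).prod 𝓘(ℝ, EQ)) ∞
        D.symm := by
  have hb := contMDiff_orbitMk hQG hεs
  have := isManifold_fibredTangent (EX := EP) hεs
  have := isManifold_fibredTangent (EX := EP) hb
  refine ⟨Equiv.ofBijective _ (bijective_tangentProj_momentum hQ hQG hreg), fun z => rfl,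
    contMDiff_symm_of_bijective_mfderiv _
      ((contMDiff_tangentProj hQG hεs).prodMk (contMDiff_momentum hQ hεs hL hδ)) fun z => ?_⟩
  let A : EP × EQ →ₗ[ℝ] (EP × EB) × (EG →L[ℝ] ℝ) :=
    (mfderiv (𝓘(ℝ, EP).prod 𝓘(ℝ, EQ)) ((𝓘(ℝ, EP).prod 𝓘(ℝ, EB)).prod 𝓘(ℝ, EG →L[ℝ] ℝ))
      (fun z : FibredTangent EQ ε => (tangentProj G EB z, momentum G L δ z)) z :
        EP × EQ →L[ℝ] (EP × EB) × (EG →L[ℝ] ℝ)).toLinearMap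
  have hinj : Function.Injective A :=
    injective_mfderiv_tangentProj_momentum hQ hQG hεs hL hδ hreg z
  have hdual : Module.finrank ℝ (EG →L[ℝ] ℝ) = Module.finrank ℝ EG :=
    (LinearMap.toContinuousLinearMap (𝕜 := ℝ) (E := EG) (F' := ℝ)).finrank_eq.symm.trans
      Subspace.dual_finrank_eq
  have hdim := (exists_infAction_eq_of_mfderiv_mk_eq_zero hQ hQG (ε z.proj)
    (injective_infAction hreg z.proj)).1
  -- Both sides equal `dim P + dim Q/G + dim G`.
  have hrank : Module.finrank ℝ (EP × EQ) = Module.finrank ℝ ((EP × EB) × (EG →L[ℝ] ℝ)) := by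
    rw [Module.finrank_prod, Module.finrank_prod, Module.finrank_prod, hdual, hdim]
    omega
  exact ⟨hinj, (LinearMap.injective_iff_surjective_of_finrank_eq_finrank hrank).1 hinj⟩

end TangentProj

/-- A smooth map with smooth local sections through every point is a submersion. -/
theorem isSubmersion_of_local_sections
    {E : Type*} [NormedAddCommGroup E] [NormedSpace ℝ E] [FiniteDimensional ℝ E]
    {H : Type*} [TopologicalSpace H] {I : ModelWithCorners ℝ E H} [I.Boundaryless]
    {M : Type*} [TopologicalSpace M] [ChartedSpace H M] [IsManifold I ∞ M]
    {E' : Type*} [NormedAddCommGroup E'] [NormedSpace ℝ E'] [FiniteDimensional ℝ E']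
    {H' : Type*} [TopologicalSpace H'] {J : ModelWithCorners ℝ E' H'}
    {N : Type*} [TopologicalSpace N] [ChartedSpace H' N] [IsManifold J ∞ N]
    {f : M → N} (hf : ContMDiff I J ∞ f)
    (h : ∀ x, ∃ s : N → M, ContMDiffAt J I ∞ s (f x) ∧ s (f x) = x ∧ ∀ᶠ y in 𝓝 (f x), f (s y) = y) :
    IsSubmersion I J ∞ f :=
  isSubmersion_of_surjective_mfderiv hf fun x =>
    let ⟨_, hs, hsx, hfs⟩ := h x
    surjective_mfderiv_of_local_section (hf.mdifferentiableAt (by simp))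
      (hs.mdifferentiableAt (by simp)) hsx hfs

/-- Transports a vector between tangent spaces at equal points through fibre coordinates, which
keeps the formula smooth even where the points are not known to be equal. -/
theorem mk_tangentCoordSymm_eq {E : Type*} [NormedAddCommGroup E] [NormedSpace ℝ E]
    {M : Type*} [TopologicalSpace M] [ChartedSpace E M] [IsManifold 𝓘(ℝ, E) ∞ M] {m₀ m m' : M}
    (h : m = m') (hm : m' ∈ (trivializationAt E (TangentSpace 𝓘(ℝ, E)) m₀).baseSet) (v : E) :
    (⟨m, tangentCoordSymm E m₀ m (tangentCoord E m₀ m' v)⟩ : TangentBundle 𝓘(ℝ, E) M) =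
      ⟨m', v⟩ := by
  subst h
  exact congrArg (TotalSpace.mk m) (tangentCoordSymm_tangentCoord hm v)

/-! ### The level set as a submanifold diffeomorphic to `T_P (Q/G)` -/

section LevelSet

variable {EG : Type*} [NormedAddCommGroup EG] [NormedSpace ℝ EG] [FiniteDimensional ℝ EG]
  {G : Type*} [TopologicalSpace G] [SecondCountableTopology G] [ChartedSpace EG G] [Group G]
  [LieGroup 𝓘(ℝ, EG) ∞ G]
  {EQ : Type*} [NormedAddCommGroup EQ] [NormedSpace ℝ EQ] [FiniteDimensional ℝ EQ]
  {Q : Type*} [TopologicalSpace Q] [ChartedSpace EQ Q] [IsManifold 𝓘(ℝ, EQ) ∞ Q]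
  [MulAction Gᵐᵒᵖ Q]
  {EP : Type*} [NormedAddCommGroup EP] [NormedSpace ℝ EP] [FiniteDimensional ℝ EP]
  {P : Type*} [TopologicalSpace P] [ChartedSpace EP P] [IsManifold 𝓘(ℝ, EP) ∞ P]
  {EB : Type*} [NormedAddCommGroup EB] [NormedSpace ℝ EB] [FiniteDimensional ℝ EB]
  [ChartedSpace EB (MulAction.orbitRel.Quotient Gᵐᵒᵖ Q)]
  [IsManifold 𝓘(ℝ, EB) ∞ (MulAction.orbitRel.Quotient Gᵐᵒᵖ Q)]
  {ε : C(P, Q)}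

/-- Each level set of the momentum map is a section of `T_P Q → T_P (Q/G)`. -/
theorem exists_levelSet_homeomorph (hQ : IsSmoothFreeProper EG G EQ Q)
    (hQG : IsQuotientManifold EQ EB (MulAction.orbitRel Gᵐᵒᵖ Q))
    (hεs : ContMDiff 𝓘(ℝ, EP) 𝓘(ℝ, EQ) ∞ ε)
    {L : FibredTangent EQ ε → ℝ} (hL : ContMDiff (𝓘(ℝ, EP).prod 𝓘(ℝ, EQ)) 𝓘(ℝ, ℝ) ∞ L)
    {δ : P → EG →L[ℝ] ℝ} (hδ : ContMDiff 𝓘(ℝ, EP) 𝓘(ℝ, EG →L[ℝ] ℝ) ∞ δ)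
    (hreg : IsGRegular G L δ) (μ : EG →L[ℝ] ℝ) :
    ∃ h : levelSet G L δ μ ≃ₜ FibredTangent EB (orbitMk G ε),
      (∀ z, h z = tangentProj G EB z.1) ∧
      ContMDiff (𝓘(ℝ, EP).prod 𝓘(ℝ, EB)) (𝓘(ℝ, EP).prod 𝓘(ℝ, EQ)) ∞
        (fun r => (h.symm r : FibredTangent EQ ε)) := by
  obtain ⟨D, hD, hDs⟩ := exists_equiv_tangentProj_momentum hQ hQG hεs hL hδ hreg
  -- The inverse of the diffeomorphism, restricted to the slice with momentum `μ`.
  have hs : ContMDiff (𝓘(ℝ, EP).prod 𝓘(ℝ, EB)) (𝓘(ℝ, EP).prod 𝓘(ℝ, EQ)) ∞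
      (fun r => D.symm (r, μ)) := hDs.comp (contMDiff_id.prodMk contMDiff_const)
  have hDr : ∀ r, (tangentProj G EB (D.symm (r, μ)), momentum G L δ (D.symm (r, μ))) = (r, μ) :=
    fun r => by rw [← hD, D.apply_symm_apply]
  refine ⟨
    { toFun := fun z => tangentProj G EB z.1
      invFun := fun r => ⟨D.symm (r, μ), congrArg Prod.snd (hDr r)⟩
      left_inv := fun z => Subtype.ext ?_
      right_inv := fun r => congrArg Prod.fst (hDr r)
      continuous_toFun := (contMDiff_tangentProj hQG hεs).continuous.comp continuous_subtype_val
      continuous_invFun := hs.continuous.subtype_mk _ }, fun z => rfl, hs⟩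
  have hz : momentum G L δ z.1 = μ := z.2
  change D.symm (tangentProj G EB z.1, μ) = z.1
  rw [Equiv.symm_apply_eq, hD, hz]

/-- The smooth structure is carried over from `T_P (Q/G)`. The inclusion is an immersion because
moving each point along its infinitesimal orbit directions to momentum `μ` is a smooth retraction of
all of `T_P Q` onto the level set. -/
theorem exists_isEmbeddedSubmanifold_levelSet (hQ : IsSmoothFreeProper EG G EQ Q)
    (hQG : IsQuotientManifold EQ EB (MulAction.orbitRel Gᵐᵒᵖ Q))
    (hεs : ContMDiff 𝓘(ℝ, EP) 𝓘(ℝ, EQ) ∞ ε)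
    {L : FibredTangent EQ ε → ℝ} (hL : ContMDiff (𝓘(ℝ, EP).prod 𝓘(ℝ, EQ)) 𝓘(ℝ, ℝ) ∞ L)
    {δ : P → EG →L[ℝ] ℝ} (hδ : ContMDiff 𝓘(ℝ, EP) 𝓘(ℝ, EG →L[ℝ] ℝ) ∞ δ)
    (hreg : IsGRegular G L δ) (μ : EG →L[ℝ] ℝ) :
    ∃ (d : ℕ) (_ : ChartedSpace (EuclideanSpace ℝ (Fin d)) (levelSet G L δ μ)),
      IsEmbeddedSubmanifold (𝓘(ℝ, EP).prod 𝓘(ℝ, EQ)) (EuclideanSpace ℝ (Fin d))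
        (levelSet G L δ μ) := by
  obtain ⟨h, hh, hhs⟩ := exists_levelSet_homeomorph hQ hQG hεs hL hδ hreg μ
  have := isManifold_fibredTangent (EX := EP) hεs
  have := isManifold_fibredTangent (EX := EP) (contMDiff_orbitMk hQG hεs)
  obtain ⟨c, hm, hsm, hsm'⟩ := exists_chartedSpace_of_homeomorph (I := 𝓘(ℝ, EP).prod 𝓘(ℝ, EB)) h
    (ContinuousLinearEquiv.ofFinrankEq (𝕜 := ℝ) (E := EP × EB)
      (F := EuclideanSpace ℝ (Fin (Module.finrank ℝ (EP × EB)))) (by simp))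
  refine ⟨_, c, hm, ?_, .subtypeVal⟩
  refine isImmersion_of_leftInverse (r := fun z => h.symm (tangentProj G EB z)) ?_
    (hsm'.comp (contMDiff_tangentProj hQG hεs)) fun z => ?_
  · exact (hhs.comp hsm).congr fun z => by simp
  · exact (congrArg h.symm (hh z).symm).trans (h.symm_apply_apply z)

variable {EN : Type*} [NormedAddCommGroup EN] [NormedSpace ℝ EN]

/-- Every embedded submanifold structure on a level set of the momentum map makes it diffeomorphic
to `T_P (Q/G)`. -/
theorem exists_levelSet_diffeomorph (hQ : IsSmoothFreeProper EG G EQ Q)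
    (hQG : IsQuotientManifold EQ EB (MulAction.orbitRel Gᵐᵒᵖ Q))
    (hεs : ContMDiff 𝓘(ℝ, EP) 𝓘(ℝ, EQ) ∞ ε)
    {L : FibredTangent EQ ε → ℝ} (hL : ContMDiff (𝓘(ℝ, EP).prod 𝓘(ℝ, EQ)) 𝓘(ℝ, ℝ) ∞ L)
    {δ : P → EG →L[ℝ] ℝ} (hδ : ContMDiff 𝓘(ℝ, EP) 𝓘(ℝ, EG →L[ℝ] ℝ) ∞ δ)
    (hreg : IsGRegular G L δ) (μ : EG →L[ℝ] ℝ) [ChartedSpace EN (levelSet G L δ μ)]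
    (hS : IsEmbeddedSubmanifold (𝓘(ℝ, EP).prod 𝓘(ℝ, EQ)) EN (levelSet G L δ μ)) :
    ∃ h : Diffeomorph 𝓘(ℝ, EN) (𝓘(ℝ, EP).prod 𝓘(ℝ, EB)) (levelSet G L δ μ)
      (FibredTangent EB (orbitMk G ε)) ∞, ∀ z, h z = tangentProj G EB z.1 := by
  obtain ⟨h, hh, hhs⟩ := exists_levelSet_homeomorph hQ hQG hεs hL hδ hreg μ
  have := isManifold_fibredTangent (EX := EP) hεs
  have := hS.isManifold
  refine ⟨⟨h.toEquiv, ?_, ?_⟩, hh⟩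
  · exact ((contMDiff_tangentProj hQG hεs).comp hS.isSmoothEmbedding.isImmersion.contMDiff).congr hh
  -- A continuous map into an immersed manifold is smooth as soon as its composition with the
  -- immersion is.
  · exact (ContMDiff.iff_comp_isImmersion hS.isSmoothEmbedding.isImmersion).2
      ⟨h.symm.continuous, hhs⟩

end LevelSet

/-! ### The projection from `T_P (Q/G)` to `T_{P/K} (Q/G)` -/

section Reduced

variable {G : Type*} [Group G]
  {EQ : Type*} [NormedAddCommGroup EQ] [NormedSpace ℝ EQ]
  {Q : Type*} [TopologicalSpace Q] [ChartedSpace EQ Q] [MulAction Gᵐᵒᵖ Q]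
  {EP : Type*} [NormedAddCommGroup EP] [NormedSpace ℝ EP]
  {P : Type*} [TopologicalSpace P] [ChartedSpace EP P] [MulAction Gᵐᵒᵖ P]
  {EB : Type*} [NormedAddCommGroup EB] [NormedSpace ℝ EB]
  [ChartedSpace EB (MulAction.orbitRel.Quotient Gᵐᵒᵖ Q)]
  {EC : Type*} [NormedAddCommGroup EC] [NormedSpace ℝ EC]
  {K : Subgroup G} [ChartedSpace EC (MulAction.orbitRel.Quotient K.op P)]
  {ε : C(P, Q)}

variable (K) in
/-- The map `T_P (Q/G) → T_{P/K} (Q/G)`, `(w, p) ↦ (w, [p])`. -/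
def reducedMk (hε : Equivariant G ε) (r : FibredTangent EB (orbitMk G ε)) :
    FibredTangent EB (reducedMap hε K) :=
  FibredTangent.mk EB (reducedMap hε K) (Quotient.mk (MulAction.orbitRel K.op P) r.proj) r.vel

theorem surjective_reducedMk (hε : Equivariant G ε) :
    Function.Surjective (reducedMk K hε : FibredTangent EB (orbitMk G ε) → _) := by
  rintro ⟨y, w⟩
  obtain ⟨p, rfl⟩ := Quotient.exists_rep y
  exact ⟨FibredTangent.mk EB (orbitMk G ε) p w, rfl⟩

theorem contMDiff_reducedMap (hQG : IsQuotientManifold EQ EB (MulAction.orbitRel Gᵐᵒᵖ Q))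
    (hPG : IsQuotientManifold EP EC (MulAction.orbitRel K.op P))
    (hεs : ContMDiff 𝓘(ℝ, EP) 𝓘(ℝ, EQ) ∞ ε) (hε : Equivariant G ε) :
    ContMDiff 𝓘(ℝ, EC) 𝓘(ℝ, EB) ∞ (reducedMap hε K) :=
  contMDiff_of_comp_isSubmersion hPG.isSubmersion Quotient.mk_surjective
    (contMDiff_orbitMk hQG hεs)

variable [IsManifold 𝓘(ℝ, EB) ∞ (MulAction.orbitRel.Quotient Gᵐᵒᵖ Q)]

theorem contMDiff_reducedMk (hQG : IsQuotientManifold EQ EB (MulAction.orbitRel Gᵐᵒᵖ Q))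
    (hPG : IsQuotientManifold EP EC (MulAction.orbitRel K.op P))
    (hεs : ContMDiff 𝓘(ℝ, EP) 𝓘(ℝ, EQ) ∞ ε) (hε : Equivariant G ε) :
    ContMDiff (𝓘(ℝ, EP).prod 𝓘(ℝ, EB)) (𝓘(ℝ, EC).prod 𝓘(ℝ, EB)) ∞
      (reducedMk K hε : FibredTangent EB (orbitMk G ε) → _) := by
  have hb := contMDiff_orbitMk hQG hεs
  rw [contMDiff_fibredTangent_iff (contMDiff_reducedMap hQG hPG hεs hε)]
  exact ⟨hPG.isSubmersion.contMDiff.comp (contMDiff_proj_fibredTangent hb), contMDiff_lift hb⟩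

/-- The map `T_P (Q/G) → T_{P/K} (Q/G)` has smooth local sections. -/
theorem exists_local_section_reducedMk
    (hQG : IsQuotientManifold EQ EB (MulAction.orbitRel Gᵐᵒᵖ Q))
    (hPG : IsQuotientManifold EP EC (MulAction.orbitRel K.op P))
    (hεs : ContMDiff 𝓘(ℝ, EP) 𝓘(ℝ, EQ) ∞ ε) (hε : Equivariant G ε)
    (r : FibredTangent EB (orbitMk G ε)) :
    ∃ s : FibredTangent EB (reducedMap hε K) → FibredTangent EB (orbitMk G ε),
      ContMDiffAt (𝓘(ℝ, EC).prod 𝓘(ℝ, EB)) (𝓘(ℝ, EP).prod 𝓘(ℝ, EB)) ∞ s (reducedMk K hε r) ∧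
      s (reducedMk K hε r) = r ∧
      ∀ᶠ y in 𝓝 (reducedMk K hε r), reducedMk K hε (s y) = y := by
  have hb := contMDiff_orbitMk hQG hεs
  have hr := contMDiff_reducedMap hQG hPG hεs hε
  obtain ⟨σ, hσ, hσp, hσs⟩ := exists_local_section (hPG.isSubmersion.isSubmersionAt r.proj)
  have hbase : orbitMk G ε r.proj ∈
      (trivializationAt EB (TangentSpace 𝓘(ℝ, EB)) (orbitMk G ε r.proj)).baseSet :=
    mem_baseSet_trivializationAt _ _ _
  -- The base point is lifted by the section `σ` of `P → P/K` and the vector keeps its coordinates.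
  -- Its old and new base points in `Q/G` need coincide only where `σ` is a section, so a direct
  -- cast is not available globally.
  refine ⟨fun y => FibredTangent.mk EB (orbitMk G ε) (σ y.proj)
    (tangentCoordSymm EB (orbitMk G ε r.proj) (orbitMk G ε (σ y.proj))
      (tangentCoord EB (orbitMk G ε r.proj) (reducedMap hε K y.proj) y.vel)), ?_, ?_, ?_⟩
  · have h1 := contMDiff_proj_fibredTangent hr (reducedMk K hε r)
    have h2 : ContMDiffAt (𝓘(ℝ, EC).prod 𝓘(ℝ, EB)) 𝓘(ℝ, EP) ∞
        (fun y : FibredTangent EB (reducedMap hε K) => σ y.proj) (reducedMk K hε r) :=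
      ContMDiffAt.comp (reducedMk K hε r) hσ h1
    have h3 := h2.prodMk (contMDiffAt_tangentCoord hr (reducedMk K hε r))
    have h4 := contMDiffAt_mk_tangentCoordSymm hb (orbitMk G ε r.proj)
      (σ (reducedMk K hε r).proj) (by rw [show σ (reducedMk K hε r).proj = r.proj from hσp]; exact hbase)
      (tangentCoord EB (orbitMk G ε r.proj) (reducedMap hε K (reducedMk K hε r).proj)
        (reducedMk K hε r).vel)
    exact ContMDiffAt.comp (reducedMk K hε r) h4 h3
  · refine FibredTangent.ext_lift hσp ?_
    exact mk_tangentCoordSymm_eq (congrArg (orbitMk G ε) hσp) hbase r.vel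
  · have h5 : ∀ᶠ y : FibredTangent EB (reducedMap hε K) in 𝓝 (reducedMk K hε r),
        Quotient.mk (MulAction.orbitRel K.op P) (σ y.proj) = y.proj :=
      (contMDiff_proj_fibredTangent hr).continuous.tendsto (reducedMk K hε r) hσs
    have h6 : ∀ᶠ y : FibredTangent EB (reducedMap hε K) in 𝓝 (reducedMk K hε r),
        reducedMap hε K y.proj ∈
          (trivializationAt EB (TangentSpace 𝓘(ℝ, EB)) (orbitMk G ε r.proj)).baseSet :=
      (hr.continuous.comp (contMDiff_proj_fibredTangent hr).continuous).continuousAt.eventually_mem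
        ((Trivialization.open_baseSet _).mem_nhds hbase)
    filter_upwards [h5, h6] with y hy hy'
    exact FibredTangent.ext_lift hy
      (mk_tangentCoordSymm_eq (congrArg (reducedMap hε K) hy) hy' y.vel)

end Reduced

/-! ### Invariance under the lifted action -/

section Orbits

variable {EG : Type*} [NormedAddCommGroup EG] [NormedSpace ℝ EG]
  {G : Type*} [TopologicalSpace G] [ChartedSpace EG G] [Group G]
  {EQ : Type*} [NormedAddCommGroup EQ] [NormedSpace ℝ EQ]
  {Q : Type*} [TopologicalSpace Q] [ChartedSpace EQ Q] [MulAction Gᵐᵒᵖ Q]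
  {P : Type*} [TopologicalSpace P] [MulAction Gᵐᵒᵖ P]
  {EB : Type*} [NormedAddCommGroup EB] [NormedSpace ℝ EB]
  [ChartedSpace EB (MulAction.orbitRel.Quotient Gᵐᵒᵖ Q)]
  {ε : C(P, Q)} {K : Subgroup G}

/-- Inside `TQ` the cast in `liftedAct` disappears, and the chain rule for tangent maps becomes
available. -/
theorem lift_liftedAct (hε : Equivariant G ε) (g : G) (z : FibredTangent EQ ε) :
    (liftedAct hε g z).lift =
      tangentMap 𝓘(ℝ, EQ) 𝓘(ℝ, EQ) (fun q : Q => op g • q) z.lift :=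
  TotalSpace.ext (hε g z.proj) (liftedAct_snd hε g z)

/-- The map `T_P Q → T_{P/K} (Q/G)` is invariant under `K`. -/
theorem reducedMk_tangentProj_liftedAct (hQ : IsSmoothFreeProper EG G EQ Q)
    (hQG : IsQuotientManifold EQ EB (MulAction.orbitRel Gᵐᵒᵖ Q))
    (hε : Equivariant G ε) {g : G} (hg : g ∈ K) (z : FibredTangent EQ ε) :
    reducedMk K hε (tangentProj G EB (liftedAct hε g z)) =
      reducedMk K hε (tangentProj G EB z) := by
  refine FibredTangent.ext_lift (Quotient.sound ⟨⟨op g, hg⟩, rfl⟩) ?_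
  change tangentMap 𝓘(ℝ, EQ) 𝓘(ℝ, EB) (Quotient.mk (MulAction.orbitRel Gᵐᵒᵖ Q))
      (liftedAct hε g z).lift =
    tangentMap 𝓘(ℝ, EQ) 𝓘(ℝ, EB) (Quotient.mk (MulAction.orbitRel Gᵐᵒᵖ Q)) z.lift
  have hc : Quotient.mk (MulAction.orbitRel Gᵐᵒᵖ Q) ∘ (fun q : Q => op g • q) =
      Quotient.mk (MulAction.orbitRel Gᵐᵒᵖ Q) :=
    funext fun q => Quotient.sound ⟨op g, rfl⟩
  rw [lift_liftedAct]
  have h := tangentMap_comp_at (I := 𝓘(ℝ, EQ)) (I' := 𝓘(ℝ, EQ)) (I'' := 𝓘(ℝ, EB)) z.lift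
    (hQG.isSubmersion.contMDiff.mdifferentiableAt (x := op g • z.lift.proj) (by simp))
    (mdifferentiable_act hQ g z.lift.proj)
  rw [← h, hc]

end Orbits

/-! ### Fibres as isotropy orbits, and the quotient as a topological space -/

section Reduction

variable {EG : Type*} [NormedAddCommGroup EG] [NormedSpace ℝ EG] [FiniteDimensional ℝ EG]
  {G : Type*} [TopologicalSpace G] [SecondCountableTopology G] [ChartedSpace EG G] [Group G]
  [LieGroup 𝓘(ℝ, EG) ∞ G]
  {EQ : Type*} [NormedAddCommGroup EQ] [NormedSpace ℝ EQ] [FiniteDimensional ℝ EQ]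
  {Q : Type*} [TopologicalSpace Q] [ChartedSpace EQ Q] [IsManifold 𝓘(ℝ, EQ) ∞ Q]
  [MulAction Gᵐᵒᵖ Q]
  {EP : Type*} [NormedAddCommGroup EP] [NormedSpace ℝ EP]
  {P : Type*} [TopologicalSpace P] [ChartedSpace EP P] [MulAction Gᵐᵒᵖ P]
  {EB : Type*} [NormedAddCommGroup EB] [NormedSpace ℝ EB] [FiniteDimensional ℝ EB]
  [ChartedSpace EB (MulAction.orbitRel.Quotient Gᵐᵒᵖ Q)]
  {ε : C(P, Q)}

/-- On a level set of the momentum map, the fibres of the map to `T_{P/G_μ} (Q/G)` are the orbits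
of `G_μ`. -/
theorem exists_eq_liftedAct (hQ : IsSmoothFreeProper EG G EQ Q)
    (hQG : IsQuotientManifold EQ EB (MulAction.orbitRel Gᵐᵒᵖ Q))
    (hεs : ContMDiff 𝓘(ℝ, EP) 𝓘(ℝ, EQ) ∞ ε) (hε : Equivariant G ε)
    {L : FibredTangent EQ ε → ℝ} (hL : ContMDiff (𝓘(ℝ, EP).prod 𝓘(ℝ, EQ)) 𝓘(ℝ, ℝ) ∞ L)
    (hLinv : ∀ (g : G) (z : FibredTangent EQ ε), L (liftedAct hε g z) = L z)
    {δ : P → EG →L[ℝ] ℝ} (hreg : IsGRegular G L δ) {μ : EG →L[ℝ] ℝ}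
    {z z' : FibredTangent EQ ε} (hz : z ∈ levelSet G L δ μ) (hz' : z' ∈ levelSet G L δ μ)
    (h : reducedMk (isotropy G δ μ) hε (tangentProj G EB z) =
      reducedMk (isotropy G δ μ) hε (tangentProj G EB z')) :
    ∃ g ∈ isotropy G δ μ, z' = liftedAct hε g z := by
  -- The equality is oriented so that the group element obtained carries `z.proj` to `z'.proj`.
  have hproj : Quotient.mk (MulAction.orbitRel (isotropy G δ μ).op P) z'.proj =
      Quotient.mk _ z.proj := (congrArg TotalSpace.proj h).symm
  obtain ⟨⟨g, hg⟩, hgp⟩ := Quotient.exact hproj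
  have hg' : g.unop ∈ isotropy G δ μ := hg
  refine ⟨g.unop, hg', ?_⟩
  -- As `g` lies in `G_μ`, the translate of `z` keeps momentum `μ`. It then shares base point,
  -- reduced velocity and momentum with `z'`.
  have hJ : momentum G L δ (liftedAct hε g.unop z) = μ :=
    liftedAct_mem_levelSet hQ hεs hε hL hLinv hg' hz
  refine (bijective_tangentProj_momentum (EB := EB) hQ hQG hreg).1 (Prod.ext ?_ ?_)
  · refine FibredTangent.ext_lift hgp.symm ?_
    have h1 := h.symm.trans (reducedMk_tangentProj_liftedAct hQ hQG hε hg' z).symm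
    have h2 := congrArg FibredTangent.lift h1
    exact h2
  · exact (show momentum G L δ z' = μ from hz').trans hJ.symm

variable [FiniteDimensional ℝ EP] [IsManifold 𝓘(ℝ, EP) ∞ P]
  [IsManifold 𝓘(ℝ, EB) ∞ (MulAction.orbitRel.Quotient Gᵐᵒᵖ Q)]
  {EC : Type*} [NormedAddCommGroup EC] [NormedSpace ℝ EC]
  {EN : Type*} [NormedAddCommGroup EN] [NormedSpace ℝ EN]

/-- The map `J⁻¹(μ) → T_{P/G_μ} (Q/G)` is a surjective submersion with smooth local sections. -/
theorem exists_local_section_levelSet (hQ : IsSmoothFreeProper EG G EQ Q)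
    (hQG : IsQuotientManifold EQ EB (MulAction.orbitRel Gᵐᵒᵖ Q))
    (hεs : ContMDiff 𝓘(ℝ, EP) 𝓘(ℝ, EQ) ∞ ε) (hε : Equivariant G ε)
    {L : FibredTangent EQ ε → ℝ} (hL : ContMDiff (𝓘(ℝ, EP).prod 𝓘(ℝ, EQ)) 𝓘(ℝ, ℝ) ∞ L)
    {δ : P → EG →L[ℝ] ℝ} (hδ : ContMDiff 𝓘(ℝ, EP) 𝓘(ℝ, EG →L[ℝ] ℝ) ∞ δ)
    (hreg : IsGRegular G L δ) {μ : EG →L[ℝ] ℝ}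
    [ChartedSpace EC (MulAction.orbitRel.Quotient (isotropy G δ μ).op P)]
    (hPG : IsQuotientManifold EP EC (MulAction.orbitRel (isotropy G δ μ).op P))
    [ChartedSpace EN (levelSet G L δ μ)]
    (hS : IsEmbeddedSubmanifold (𝓘(ℝ, EP).prod 𝓘(ℝ, EQ)) EN (levelSet G L δ μ)) :
    let f : levelSet G L δ μ → FibredTangent EB (reducedMap hε (isotropy G δ μ)) :=
      fun z => reducedMk (isotropy G δ μ) hε (tangentProj G EB z.1)
    ContMDiff 𝓘(ℝ, EN) (𝓘(ℝ, EC).prod 𝓘(ℝ, EB)) ∞ f ∧ Function.Surjective f ∧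
    ∀ z, ∃ s : FibredTangent EB (reducedMap hε (isotropy G δ μ)) → levelSet G L δ μ,
      ContMDiffAt (𝓘(ℝ, EC).prod 𝓘(ℝ, EB)) 𝓘(ℝ, EN) ∞ s (f z) ∧ s (f z) = z ∧
      ∀ᶠ y in 𝓝 (f z), f (s y) = y := by
  intro f
  obtain ⟨h, hh⟩ := exists_levelSet_diffeomorph hQ hQG hεs hL hδ hreg μ hS
  have hf : f = reducedMk (isotropy G δ μ) hε ∘ h := funext fun z => by
    simp only [f, Function.comp_apply, hh]
  rw [hf]
  refine ⟨(contMDiff_reducedMk hQG hPG hεs hε).comp h.contMDiff,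
    (surjective_reducedMk hε).comp h.surjective, fun z => ?_⟩
  obtain ⟨s, hs, hsz, hfs⟩ := exists_local_section_reducedMk hQG hPG hεs hε (h z)
  refine ⟨h.symm ∘ s, h.symm.contMDiff.contMDiffAt.comp _ hs, ?_, ?_⟩
  · simp only [Function.comp_apply]
    rw [hsz, h.symm_apply_apply]
  · filter_upwards [hfs] with y hy
    simpa using hy

variable [FiniteDimensional ℝ EC] [FiniteDimensional ℝ EN]

/-- The induced map `J⁻¹(μ)/G_μ → T_{P/G_μ} (Q/G)` is a homeomorphism. -/
theorem exists_quotient_homeomorph (hQ : IsSmoothFreeProper EG G EQ Q)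
    (hQG : IsQuotientManifold EQ EB (MulAction.orbitRel Gᵐᵒᵖ Q))
    (hεs : ContMDiff 𝓘(ℝ, EP) 𝓘(ℝ, EQ) ∞ ε) (hε : Equivariant G ε)
    {L : FibredTangent EQ ε → ℝ} (hL : ContMDiff (𝓘(ℝ, EP).prod 𝓘(ℝ, EQ)) 𝓘(ℝ, ℝ) ∞ L)
    (hLinv : ∀ (g : G) (z : FibredTangent EQ ε), L (liftedAct hε g z) = L z)
    {δ : P → EG →L[ℝ] ℝ} (hδ : ContMDiff 𝓘(ℝ, EP) 𝓘(ℝ, EG →L[ℝ] ℝ) ∞ δ)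
    (hreg : IsGRegular G L δ) {μ : EG →L[ℝ] ℝ}
    [ChartedSpace EC (MulAction.orbitRel.Quotient (isotropy G δ μ).op P)]
    (hPG : IsQuotientManifold EP EC (MulAction.orbitRel (isotropy G δ μ).op P))
    [ChartedSpace EN (levelSet G L δ μ)]
    (hS : IsEmbeddedSubmanifold (𝓘(ℝ, EP).prod 𝓘(ℝ, EQ)) EN (levelSet G L δ μ)) :
    ∃ Ψ : Quotient (orbitSetoid hQ hε (isotropy G δ μ) (levelSet G L δ μ)) ≃ₜ
        FibredTangent EB (reducedMap hε (isotropy G δ μ)),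
      ∀ z, Ψ (Quotient.mk _ z) = reducedMk (isotropy G δ μ) hε (tangentProj G EB z.1) := by
  obtain ⟨hf, hsurj, hsec⟩ := exists_local_section_levelSet hQ hQG hεs hε hL hδ hreg hPG hS
  set f : levelSet G L δ μ → FibredTangent EB (reducedMap hε (isotropy G δ μ)) :=
    fun z => reducedMk (isotropy G δ μ) hε (tangentProj G EB z.1)
  have := hS.isManifold
  have := hPG.isManifold
  have := isManifold_fibredTangent (EX := EC) (contMDiff_reducedMap hQG hPG hεs hε)
  have hopen : IsOpenMap f := isOpenMap_of_isSubmersion (isSubmersion_of_local_sections hf hsec)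
  have hrel : ∀ z z' : levelSet G L δ μ,
      (orbitSetoid hQ hε (isotropy G δ μ) (levelSet G L δ μ)) z z' → f z = f z' := by
    rintro z z' ⟨g, hg, hgz⟩
    simp only [f, hgz]
    exact (reducedMk_tangentProj_liftedAct hQ hQG hε hg z.1).symm
  let Ψ : Quotient (orbitSetoid hQ hε (isotropy G δ μ) (levelSet G L δ μ)) →
      FibredTangent EB (reducedMap hε (isotropy G δ μ)) := Quotient.lift f hrel
  have hΨc : Continuous Ψ := hf.continuous.quotient_lift hrel
  have hΨi : Function.Injective Ψ := by
    intro a b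
    induction a, b using Quotient.inductionOn₂ with
    | h z z' =>
      exact fun h => Quotient.sound
        (exists_eq_liftedAct hQ hQG hεs hε hL hLinv hreg z.2 z'.2 h)
  have hΨs : Function.Surjective Ψ := Quotient.lift_surjective f hrel hsurj
  have hΨo : IsOpenMap Ψ := by
    intro U hU
    have h := hopen (Quotient.mk _ ⁻¹' U) (hU.preimage continuous_quotient_mk')
    rwa [show f = Ψ ∘ Quotient.mk _ from rfl, image_comp,
      image_preimage_eq U Quotient.mk_surjective] at h
  exact ⟨(Equiv.ofBijective Ψ ⟨hΨi, hΨs⟩).toHomeomorphOfContinuousOpen hΨc hΨo, fun z => rfl⟩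

end Reduction

/-! ### Smooth structure of the quotient -/

section QuotientStructure

variable {EG : Type*} [NormedAddCommGroup EG] [NormedSpace ℝ EG] [FiniteDimensional ℝ EG]
  {G : Type*} [TopologicalSpace G] [SecondCountableTopology G] [ChartedSpace EG G] [Group G]
  [LieGroup 𝓘(ℝ, EG) ∞ G]
  {EQ : Type*} [NormedAddCommGroup EQ] [NormedSpace ℝ EQ] [FiniteDimensional ℝ EQ]
  {Q : Type*} [TopologicalSpace Q] [ChartedSpace EQ Q] [IsManifold 𝓘(ℝ, EQ) ∞ Q]
  [MulAction Gᵐᵒᵖ Q]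
  {EP : Type*} [NormedAddCommGroup EP] [NormedSpace ℝ EP] [FiniteDimensional ℝ EP]
  {P : Type*} [TopologicalSpace P] [ChartedSpace EP P] [IsManifold 𝓘(ℝ, EP) ∞ P]
  [MulAction Gᵐᵒᵖ P]
  {EB : Type*} [NormedAddCommGroup EB] [NormedSpace ℝ EB] [FiniteDimensional ℝ EB]
  [ChartedSpace EB (MulAction.orbitRel.Quotient Gᵐᵒᵖ Q)]
  [IsManifold 𝓘(ℝ, EB) ∞ (MulAction.orbitRel.Quotient Gᵐᵒᵖ Q)]
  {EC : Type*} [NormedAddCommGroup EC] [NormedSpace ℝ EC] [FiniteDimensional ℝ EC]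
  {EN : Type*} [NormedAddCommGroup EN] [NormedSpace ℝ EN] [FiniteDimensional ℝ EN]
  {ε : C(P, Q)}

/-- The quotient `J⁻¹(μ)/G_μ` is a quotient manifold. -/
theorem exists_isQuotientManifold_levelSet (hQ : IsSmoothFreeProper EG G EQ Q)
    (hQG : IsQuotientManifold EQ EB (MulAction.orbitRel Gᵐᵒᵖ Q))
    (hεs : ContMDiff 𝓘(ℝ, EP) 𝓘(ℝ, EQ) ∞ ε) (hε : Equivariant G ε)
    {L : FibredTangent EQ ε → ℝ} (hL : ContMDiff (𝓘(ℝ, EP).prod 𝓘(ℝ, EQ)) 𝓘(ℝ, ℝ) ∞ L)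
    (hLinv : ∀ (g : G) (z : FibredTangent EQ ε), L (liftedAct hε g z) = L z)
    {δ : P → EG →L[ℝ] ℝ} (hδ : ContMDiff 𝓘(ℝ, EP) 𝓘(ℝ, EG →L[ℝ] ℝ) ∞ δ)
    (hreg : IsGRegular G L δ) {μ : EG →L[ℝ] ℝ}
    [ChartedSpace EC (MulAction.orbitRel.Quotient (isotropy G δ μ).op P)]
    (hPG : IsQuotientManifold EP EC (MulAction.orbitRel (isotropy G δ μ).op P))
    [ChartedSpace EN (levelSet G L δ μ)]
    (hS : IsEmbeddedSubmanifold (𝓘(ℝ, EP).prod 𝓘(ℝ, EQ)) EN (levelSet G L δ μ)) :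
    ∃ (k : ℕ) (_ : ChartedSpace (EuclideanSpace ℝ (Fin k))
        (Quotient (orbitSetoid hQ hε (isotropy G δ μ) (levelSet G L δ μ)))),
      IsQuotientManifold EN (EuclideanSpace ℝ (Fin k))
        (orbitSetoid hQ hε (isotropy G δ μ) (levelSet G L δ μ)) := by
  obtain ⟨Ψ, hΨ⟩ := exists_quotient_homeomorph hQ hQG hεs hε hL hLinv hδ hreg hPG hS
  obtain ⟨hf, -, hsec⟩ := exists_local_section_levelSet hQ hQG hεs hε hL hδ hreg hPG hS
  have := hS.isManifold
  have := hPG.isManifold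
  have := isManifold_fibredTangent (EX := EC) (contMDiff_reducedMap hQG hPG hεs hε)
  obtain ⟨c, hm, hsm, hsm'⟩ := exists_chartedSpace_of_homeomorph (I := 𝓘(ℝ, EC).prod 𝓘(ℝ, EB)) Ψ
    (ContinuousLinearEquiv.ofFinrankEq (𝕜 := ℝ) (E := EC × EB)
      (F := EuclideanSpace ℝ (Fin (Module.finrank ℝ (EC × EB)))) (by simp))
  refine ⟨_, c, hm, isSubmersion_of_local_sections ?_ fun z => ?_⟩
  · exact (hsm'.comp hf).congr fun z => by simp [← hΨ]
  · obtain ⟨s, hs, hsz, hfs⟩ := hsec z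
    simp only [← hΨ] at hs hsz hfs
    -- A local section of `f = Ψ ∘ [·]` composed with `Ψ` is a local section of the quotient
    -- projection.
    refine ⟨s ∘ Ψ, hs.comp _ hsm.contMDiffAt, hsz, ?_⟩
    filter_upwards [Ψ.continuous.tendsto _ hfs] with y hy
    exact Ψ.injective hy

/-- Every quotient manifold structure on `J⁻¹(μ)/G_μ` makes it diffeomorphic to
`T_{P/G_μ} (Q/G)`. -/
theorem exists_quotient_diffeomorph (hQ : IsSmoothFreeProper EG G EQ Q)
    (hQG : IsQuotientManifold EQ EB (MulAction.orbitRel Gᵐᵒᵖ Q))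
    (hεs : ContMDiff 𝓘(ℝ, EP) 𝓘(ℝ, EQ) ∞ ε) (hε : Equivariant G ε)
    {L : FibredTangent EQ ε → ℝ} (hL : ContMDiff (𝓘(ℝ, EP).prod 𝓘(ℝ, EQ)) 𝓘(ℝ, ℝ) ∞ L)
    (hLinv : ∀ (g : G) (z : FibredTangent EQ ε), L (liftedAct hε g z) = L z)
    {δ : P → EG →L[ℝ] ℝ} (hδ : ContMDiff 𝓘(ℝ, EP) 𝓘(ℝ, EG →L[ℝ] ℝ) ∞ δ)
    (hreg : IsGRegular G L δ) {μ : EG →L[ℝ] ℝ}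
    [ChartedSpace EC (MulAction.orbitRel.Quotient (isotropy G δ μ).op P)]
    (hPG : IsQuotientManifold EP EC (MulAction.orbitRel (isotropy G δ μ).op P))
    [ChartedSpace EN (levelSet G L δ μ)]
    (hS : IsEmbeddedSubmanifold (𝓘(ℝ, EP).prod 𝓘(ℝ, EQ)) EN (levelSet G L δ μ))
    {ER : Type*} [NormedAddCommGroup ER] [NormedSpace ℝ ER]
    [ChartedSpace ER (Quotient (orbitSetoid hQ hε (isotropy G δ μ) (levelSet G L δ μ)))]
    (hR : IsQuotientManifold EN ER (orbitSetoid hQ hε (isotropy G δ μ) (levelSet G L δ μ))) :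
    ∃ Φ : Diffeomorph 𝓘(ℝ, ER) (𝓘(ℝ, EC).prod 𝓘(ℝ, EB))
        (Quotient (orbitSetoid hQ hε (isotropy G δ μ) (levelSet G L δ μ)))
        (FibredTangent EB (reducedMap hε (isotropy G δ μ))) ∞,
      ∀ z, Φ (Quotient.mk _ z) = reducedMk (isotropy G δ μ) hε (tangentProj G EB z.1) := by
  obtain ⟨Ψ, hΨ⟩ := exists_quotient_homeomorph hQ hQG hεs hε hL hLinv hδ hreg hPG hS
  obtain ⟨hf, hsurj, hsec⟩ := exists_local_section_levelSet hQ hQG hεs hε hL hδ hreg hPG hS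
  have := hS.isManifold
  have := hPG.isManifold
  have := isManifold_fibredTangent (EX := EC) (contMDiff_reducedMap hQG hPG hεs hε)
  -- Both directions descend along a surjective submersion: the map itself along the quotient
  -- projection, its inverse along `f`.
  refine ⟨⟨Ψ.toEquiv, ?_, ?_⟩, hΨ⟩
  · exact contMDiff_of_comp_isSubmersion hR.isSubmersion Quotient.mk_surjective (hf.congr hΨ)
  · refine contMDiff_of_comp_isSubmersion (isSubmersion_of_local_sections hf hsec) hsurj
      (hR.isSubmersion.contMDiff.congr fun z => ?_)
    exact (Equiv.symm_apply_eq _).2 (hΨ z).symm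

end QuotientStructure

end MagneticRouth

/-! ### The reduction theorem -/

theorem proposition5p7
    {EG EQ EP EF EB EC : Type*}
    [NormedAddCommGroup EG] [NormedSpace ℝ EG] [FiniteDimensional ℝ EG]
    [NormedAddCommGroup EQ] [NormedSpace ℝ EQ] [FiniteDimensional ℝ EQ]
    [NormedAddCommGroup EP] [NormedSpace ℝ EP] [FiniteDimensional ℝ EP]
    [NormedAddCommGroup EF] [NormedSpace ℝ EF] [FiniteDimensional ℝ EF]
    [NormedAddCommGroup EB] [NormedSpace ℝ EB] [FiniteDimensional ℝ EB]
    [NormedAddCommGroup EC] [NormedSpace ℝ EC] [FiniteDimensional ℝ EC]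
    -- the Lie group `G`, the manifolds `Q`, `P` and `F`
    {G : Type*} [TopologicalSpace G] [T2Space G] [SecondCountableTopology G]
    [ChartedSpace EG G] [Group G] [LieGroup 𝓘(ℝ, EG) ∞ G]
    {Q : Type*} [TopologicalSpace Q] [T2Space Q] [SecondCountableTopology Q]
    [ChartedSpace EQ Q] [IsManifold 𝓘(ℝ, EQ) ∞ Q]
    {P : Type*} [TopologicalSpace P] [T2Space P] [SecondCountableTopology P] [ConnectedSpace P]
    [ChartedSpace EP P] [IsManifold 𝓘(ℝ, EP) ∞ P]
    {F : Type*} [TopologicalSpace F] [ChartedSpace EF F] [IsManifold 𝓘(ℝ, EF) ∞ F]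
    -- the free and proper right actions of `G`
    [MulAction Gᵐᵒᵖ Q] [MulAction Gᵐᵒᵖ P]
    (hQ : IsSmoothFreeProper EG G EQ Q) (hP : IsSmoothFreeProper EG G EP P)
    -- the `G`-invariant magnetic Lagrangian system `(ε : P → Q, L, B)`
    (ε : C(P, Q)) (hεb : IsSmoothFiberBundle EP EQ EF F ε) (hε : Equivariant G ε)
    (L : FibredTangent EQ ε → ℝ)
    (hL : ContMDiff (𝓘(ℝ, EP).prod 𝓘(ℝ, EQ)) 𝓘(ℝ, ℝ) ∞ L)
    (hLinv : ∀ (g : G) (z : FibredTangent EQ ε), L (liftedAct hε g z) = L z)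
    (B : TwoForm EP P) (hB : B.IsSmoothClosed) (hBinv : B.IsInvariant G)
    -- the `B𝔤`-potential `δ`
    (δ : P → EG →L[ℝ] ℝ) (hδ : IsPotential G B δ)
    -- `G`-regularity, and the momentum value `μ`
    (hreg : IsGRegular G L δ)
    (μ : EG →L[ℝ] ℝ)
    -- the quotient manifolds `Q/G` and `P/G_μ`
    [ChartedSpace EB (MulAction.orbitRel.Quotient Gᵐᵒᵖ Q)]
    [IsManifold 𝓘(ℝ, EB) ∞ (MulAction.orbitRel.Quotient Gᵐᵒᵖ Q)]
    (hQG : IsQuotientManifold EQ EB (MulAction.orbitRel Gᵐᵒᵖ Q))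
    [ChartedSpace EC (MulAction.orbitRel.Quotient (isotropy G δ μ).op P)]
    (hPG : IsQuotientManifold EP EC (MulAction.orbitRel (isotropy G δ μ).op P)) :
    -- `J⁻¹(μ)` is an embedded submanifold of `T_P Q`, and
    (∃ (d : ℕ) (_ : ChartedSpace (EuclideanSpace ℝ (Fin d)) (levelSet G L δ μ)),
      IsEmbeddedSubmanifold (𝓘(ℝ, EP).prod 𝓘(ℝ, EQ)) (EuclideanSpace ℝ (Fin d))
        (levelSet G L δ μ)) ∧
    ∀ (d : ℕ) [ChartedSpace (EuclideanSpace ℝ (Fin d)) (levelSet G L δ μ)],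
      IsEmbeddedSubmanifold (𝓘(ℝ, EP).prod 𝓘(ℝ, EQ)) (EuclideanSpace ℝ (Fin d))
        (levelSet G L δ μ) →
      -- `J⁻¹(μ)/G_μ` is a quotient manifold of it, and
      (∃ (k : ℕ) (_ : ChartedSpace (EuclideanSpace ℝ (Fin k))
          (Quotient (orbitSetoid hQ hε (isotropy G δ μ) (levelSet G L δ μ)))),
        IsQuotientManifold (EuclideanSpace ℝ (Fin d)) (EuclideanSpace ℝ (Fin k))
          (orbitSetoid hQ hε (isotropy G δ μ) (levelSet G L δ μ))) ∧
      ∀ (k : ℕ) [ChartedSpace (EuclideanSpace ℝ (Fin k))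
          (Quotient (orbitSetoid hQ hε (isotropy G δ μ) (levelSet G L δ μ)))],
        IsQuotientManifold (EuclideanSpace ℝ (Fin d)) (EuclideanSpace ℝ (Fin k))
          (orbitSetoid hQ hε (isotropy G δ μ) (levelSet G L δ μ)) →
        -- `Π_μ : J⁻¹(μ)/G_μ → T_{P/G_μ}(Q/G)` is well defined and a diffeomorphism,
        ∃ Φ : Diffeomorph 𝓘(ℝ, EuclideanSpace ℝ (Fin k)) (𝓘(ℝ, EC).prod 𝓘(ℝ, EB))
            (Quotient (orbitSetoid hQ hε (isotropy G δ μ) (levelSet G L δ μ)))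
            (FibredTangent EB (reducedMap hε (isotropy G δ μ))) ∞,
          (∀ z : levelSet G L δ μ,
            Φ (Quotient.mk _ z) =
              FibredTangent.mk EB (reducedMap hε (isotropy G δ μ)) (Quotient.mk _ z.1.proj)
                (mfderiv 𝓘(ℝ, EQ) 𝓘(ℝ, EB) (Quotient.mk (MulAction.orbitRel Gᵐᵒᵖ Q))
                  (ε z.1.proj) z.1.vel)) ∧
          -- with inverse `(Tπ v, [p]) ↦ [(v + ξ_Q, p)]`, where `ξ` solves `J(v + ξ_Q, p) = μ`.
          ∀ (p : P) (v : TangentSpace 𝓘(ℝ, EQ) (ε p)),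
            (∃! ξ : EG, FibredTangent.mk EQ ε p (v + infAction EG EQ G (ε p) ξ) ∈
              levelSet G L δ μ) ∧
            ∀ (ξ : EG) (h : FibredTangent.mk EQ ε p (v + infAction EG EQ G (ε p) ξ) ∈
              levelSet G L δ μ),
              Φ.symm (FibredTangent.mk EB (reducedMap hε (isotropy G δ μ)) (Quotient.mk _ p)
                (mfderiv 𝓘(ℝ, EQ) 𝓘(ℝ, EB) (Quotient.mk (MulAction.orbitRel Gᵐᵒᵖ Q))
                  (ε p) v)) = Quotient.mk _ ⟨_, h⟩ := by
  have hεs := hεb.contMDiff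
  refine ⟨exists_isEmbeddedSubmanifold_levelSet hQ hQG hεs hL hδ.smooth hreg μ,
    fun d _ hS => ⟨exists_isQuotientManifold_levelSet hQ hQG hεs hε hL hLinv hδ.smooth hreg hPG hS,
      fun k _ hR => ?_⟩⟩
  obtain ⟨Φ, hΦ⟩ :=
    exists_quotient_diffeomorph hQ hQG hεs hε hL hLinv hδ.smooth hreg hPG hS hR
  refine ⟨Φ, hΦ, fun p v => ⟨existsUnique_mem_levelSet hreg μ p v, fun ξ h => ?_⟩⟩
  -- Since `Tπ` kills `ξ_Q`, the class of `(v + ξ_Q, p)` is sent by `Φ` to `(Tπ v, [p])`.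
  refine Eq.trans (congrArg Φ.symm (Eq.trans ?_ (hΦ ⟨_, h⟩).symm)) (Φ.symm_apply_apply _)
  refine congrArg (FibredTangent.mk EB (reducedMap hε (isotropy G δ μ)) (Quotient.mk _ p)) ?_
  change _ = mfderiv 𝓘(ℝ, EQ) 𝓘(ℝ, EB) (Quotient.mk (MulAction.orbitRel Gᵐᵒᵖ Q)) (ε p)
    (v + infAction EG EQ G (ε p) ξ)
  rw [map_add, mfderiv_mk_infAction hQ hQG, add_zero]
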